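/- **The complex $\Omega$.** Let $\Omega^*$ be the infinite pure simplicial $3$-complex obtained from a tetrahedron by repeated stellar subdivision of the (triangular) faces, but not of the edges: a new vertex is put into each of the four faces of the tetrahedron, this vertex and the face span a new tetrahedron, the three faces of it that contain the new vertex are subdivided in the same way, and so on indefinitely. Call two distinct vertices of $\Omega^*$ *meeting* if they lie in a common tetrahedron. (By a theorem of Scharlemann this is the complex of the thrice-punctured projective plane $N_{1,3}$: its vertices correspond to the homotopy classes of one-sided simple closed curves on $N_{1,3}$, and two of them meet when the curves intersect exactly once.) Let $\Omega$ be the dual complex: $\Omega^3$ is the set of vertices of $\Omega^*$, and $\Omega^2$, $\Omega^1$, $\Omega^0$ are the sets of the sets $\{\alpha,\beta\}$, $\{\alpha,\beta,\gamma\}$, $\{\alpha,\beta,\gamma,\delta\}$ of two, three, four distinct, pairwise meeting elements of $\Omega^3$. The $1$-skeleton of $\Omega$ (vertices $\Omega^0$, edges $\Omega^1$, an edge $\{\alpha,\beta,\gamma\}$ joining the two vertices $\{\alpha,\beta,\gamma,\delta\}$ and $\{\alpha,\beta,\gamma,\delta'\}$ that contain it) is a $4$-regular tree. Write $\{\alpha,\beta,\gamma;\delta'\to\delta\}$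 for this edge, oriented from $\{\alpha,\beta,\gamma,\delta'\}$ to $\{\alpha,\beta,\gamma,\delta\}$. **BQ-Markoff maps.** A *Markoff map* is a function $\phi:\Omega^3\to\mathbb{C}$ such that, with $a=\phi(\alpha)$, $b=\phi(\beta)$, etc., $$(a+b+c+d)^2=abcd\quad\text{for all }\{\alpha,\beta,\gamma,\delta\}\in\Omega^0,$$ $$d+d'+2a+2b+2c=abc\quad\text{for every oriented edge }\{\alpha,\beta,\gamma;\delta'\to\delta\}.$$ For $k\ge 0$ let $\Omega^2_\phi(k)=\{\{\alpha,\beta\}\in\Omega^2 : |ab|\le k\}$. A Markoff map $\phi$ is a *BQ-Markoff map* if $\Omega^2_\phi(k)$ is finite for every $k\ge 0$, and $ab\notin[0,4]$ for every $\{\alpha,\beta\}\in\Omega^2_\phi(4)$. **Fibonacci functions.** For an edge $e\in\Omega^1$, the *Fibonacci function* $F_e:\Omega^3\to\mathbb{R}$ is defined recursively on the tree by: $F_e(X)=1$ for the three $3$-cells $X\in e$; and $$F_e(\delta)=F_e(\alpha)+F_e(\beta)+F_e(\gamma)$$ for every oriented edge $\{\alpha,\beta,\gamma;\delta'\to\delta\}$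 that points away from $e$ or is one of the two orientations of $e$ itself. **Theorem (Fibonacci growth).** Let $\phi$ be a BQ-Markoff map and let $e\in\Omega^1$ be any edge. Then the Fibonacci function $F_e$ is well defined (there is exactly one function with the two properties above), and $\log^+|\phi|$ has Fibonacci growth on $\Omega^3$: there is a constant $\kappa>0$ such that $$\frac1\kappa\,F_e(X)\le \log^+|\phi(X)|\le \kappa\,F_e(X)\qquad\text{for all but finitely many }X\in\Omega^3,$$ where $\log^+ x=\max\{0,\log x\}$ (and $\log^+0=0$). -/

import Mathlib

/-!
The complex `Ω` of the thrice-punctured projective plane is used through its combinatorics. Its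
dual `Ω*` has the homotopy classes of one-sided simple closed curves as vertices, two of them being
joined when they intersect once, and its `1`-skeleton is the `1`-skeleton of the complex which is
obtained from a tetrahedron by repeated stellar subdivision of the faces, but not of the edges. This
graph is built below (`meetGraph`), and the cells of `Ω` are its cliques.
-/

namespace MarkoffQuads

/-- The `3`-cells of `Ω`, i.e. the vertices of the tetrahedron after repeated stellar subdivision of
faces. The four vertices of the tetrahedron are `base 0, …, base 3`, and `base i` has colour `i`.
A new vertex, put into a face, gets the colour that is missing in this face; it spans, together with
the face, a new tetrahedron with three new faces (those that contain the new vertex), which are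
subdivided in turn. So the new vertices correspond to the nonempty words `j :: w` in the four
colours without equal consecutive letters, the newest letter first: `apex j w` is the vertex that
is put into the face missing colour `j` of the tetrahedron that was created by the word `w`. -/
inductive Cell where
  | base (i : Fin 4) : Cell
  | apex (j : Fin 4) (w : List (Fin 4)) (h : (j :: w).IsChain (· ≠ ·)) : Cell
  deriving DecidableEq

/-- The vertex of colour `i` of the tetrahedron with word `w` (the empty word being the initial
tetrahedron). The tetrahedron with word `j :: w` arises from the one with word `w` when
its vertex of colour `j` is replaced by the new vertex `apex j w`. -/
def corner : (w : List (Fin 4)) → w.IsChain (· ≠ ·) → Fin 4 → Cell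
  | [], _, i => .base i
  | j :: w, h, i => if i = j then .apex j w h else corner w h.tail i

/-- The `1`-skeleton of `Ω*`: two different `3`-cells are joined (their curves intersect once) when
they are vertices of a common tetrahedron. -/
def meetGraph : SimpleGraph Cell where
  Adj X Y := X ≠ Y ∧ ∃ (w : List (Fin 4)) (hw : w.IsChain (· ≠ ·)) (i j : Fin 4),
    corner w hw i = X ∧ corner w hw j = Y
  symm := ⟨fun _ _ ⟨hne, w, hw, i, j, hi, hj⟩ => ⟨hne.symm, w, hw, j, i, hj, hi⟩⟩
  loopless := ⟨fun _ h => h.1 rfl⟩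

/-- The `0`-cells (vertices) of `Ω`: four pairwise meeting `3`-cells. -/
def Omega0 : Set (Finset Cell) := meetGraph.cliqueSet 4

/-- The `1`-cells (edges) of `Ω`: three pairwise meeting `3`-cells. -/
def Omega1 : Set (Finset Cell) := meetGraph.cliqueSet 3

/-- The `2`-cells (faces) of `Ω`: two meeting `3`-cells. -/
def Omega2 : Set (Finset Cell) := meetGraph.cliqueSet 2

/-- `{α, β, γ; δ' → δ}` is an oriented edge of `Ω`, where `t = {α, β, γ}`: it joins the two different
vertices `{α, β, γ, δ'}` and `{α, β, γ, δ}` of `Ω`. -/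
def IsOrientedEdge (t : Finset Cell) (δ' δ : Cell) : Prop :=
  t ∈ Omega1 ∧ δ' ∉ t ∧ δ ∉ t ∧ δ' ≠ δ ∧ insert δ' t ∈ Omega0 ∧ insert δ t ∈ Omega0

/-- The `1`-skeleton of `Ω`: two different vertices of `Ω` are joined when some edge of `Ω`
ends at both of them. (Finite sets that are not vertices of `Ω` are isolated in this graph.) -/
def skeleton : SimpleGraph (Finset Cell) where
  Adj u v := u ∈ Omega0 ∧ v ∈ Omega0 ∧ u ≠ v ∧ ∃ t ∈ Omega1, t ⊆ u ∧ t ⊆ v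
  symm := ⟨fun _ _ ⟨hu, hv, hne, t, ht, htu, htv⟩ => ⟨hv, hu, hne.symm, t, ht, htv, htu⟩⟩
  loopless := ⟨fun _ h => h.2.2.1 rfl⟩

/-- The oriented edge `{t; δ' → δ}` points away from the edge `e`: its tail is closer than its head
to an end point of `e`. For `t = e` both orientations point away. -/
def PointsAwayFrom (e t : Finset Cell) (δ' δ : Cell) : Prop :=
  ∃ u ∈ Omega0, e ⊆ u ∧ skeleton.dist u (insert δ' t) < skeleton.dist u (insert δ t)

/-- `F` is the Fibonacci function `F_e` of the edge `e`: it is `1` on the three `3`-cells that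
contain `e`, and across every oriented edge that points away from `e` (or is one of the two
orientations of `e`) the `3`-cell at the head gets the sum of the values of the three `3`-cells
that contain that edge. -/
structure IsFibonacciFunction (e : Finset Cell) (F : Cell → ℝ) : Prop where
  eq_one : ∀ X ∈ e, F X = 1
  eq_sum : ∀ (t : Finset Cell) (δ' δ : Cell), IsOrientedEdge t δ' δ →
    PointsAwayFrom e t δ' δ → F δ = ∑ X ∈ t, F X

/-- `φ` is a Markoff map: the vertex relation `(a + b + c + d)² = abcd` and the edge relation
`d + d' + 2a + 2b + 2c = abc` hold (both without denominators, as values may vanish). -/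
structure IsMarkoffMap (φ : Cell → ℂ) : Prop where
  vertex : ∀ v ∈ Omega0, (∑ X ∈ v, φ X) ^ 2 = ∏ X ∈ v, φ X
  edge : ∀ (t : Finset Cell) (δ' δ : Cell), IsOrientedEdge t δ' δ →
    φ δ + φ δ' + 2 * ∑ X ∈ t, φ X = ∏ X ∈ t, φ X

/-- The set `Ω²_φ(k)` of the `2`-cells `{α, β}` with `|φ(α) φ(β)| ≤ k`. -/
def Omega2Le (φ : Cell → ℂ) (k : ℝ) : Set (Finset Cell) :=
  {p | p ∈ Omega2 ∧ ‖∏ X ∈ p, φ X‖ ≤ k}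

/-- `φ` is a BQ-Markoff map. -/
structure IsBQMarkoffMap (φ : Cell → ℂ) : Prop extends IsMarkoffMap φ where
  finite : ∀ k : ℝ, 0 ≤ k → (Omega2Le φ k).Finite
  not_mem_Icc : ∀ p ∈ Omega2Le φ 4, ∀ r ∈ Set.Icc (0 : ℝ) 4, ∏ X ∈ p, φ X ≠ (r : ℂ)

/-- `f` has Fibonacci growth on `S`, with respect to the Fibonacci function `F`. -/
def HasFibonacciGrowthOn (F f : Cell → ℝ) (S : Set Cell) : Prop :=
  ∃ κ : ℝ, 0 < κ ∧ {X ∈ S | ¬ (1 / κ * F X ≤ f X ∧ f X ≤ κ * F X)}.Finite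

end MarkoffQuads

/-! Tetrahedra are reduced words in four colours, and passing from `w` to `j :: w` replaces only the
value of colour `j`. A Markoff map thus becomes a family `v w i` (`IsBQWordMap`), and everything is
an estimate on the rooted tree of reduced words.

Upper bound: the vertex relation is quadratic in each value `d`, with `E` and `P` the sum and the
product of the other three. It gives `|d| ≤ |P| + 3|E|`, so `log⁺|φ| + log 10` is subadditive on
every tetrahedron (`posLog_le_sum`). Comparison with the recursion for `F` finishes.

Lower bound: where a new value is at least as large as the one it replaces, `|P| ≤ 4|d|`
(`norm_prod_le`), so `h = log|φ| - log 2` satisfies the Fibonacci recursion as an inequality `≥`.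
Two problems remain. First, descents must be finite in number. After an ascent followed by a
descent, two values `x, y` dominate; if the other two are `a, b`, then `|ab| ≤ 4`, so only finitely
many pairs occur, and `ab ∉ [0,4]` bounds `xy` (`exists_bound_of_fork`). Finiteness of `Ω²_φ(k)`
then leaves finitely many descents (`finite_decreasing`).

Second, `h` may be negative on single cells, so superadditivity alone is not enough. What propagates
is the inequality `κ(F p + F q) ≤ h p + h q` for all pairs in a face (`pairGood_cons`). It can fail
to start only along words that alternate between two colours and never replace the other two values
`a, b`. There the edge relation is a linear recursion whose characteristic roots have sum `ab - 2`
and product `1`; as `ab ∉ [0,4]` they lie off the unit circle, so `h` grows at least linearly,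
whereas `F` grows at most linearly. Only finitely many such lines start at a given depth, so one `κ`
serves all of them. -/

namespace MarkoffQuads

/-! ### Combinatorics of `Ω`: tetrahedra as reduced words -/

/-- A word in the four colours without equal consecutive letters. -/
abbrev Reduced (w : List (Fin 4)) : Prop := w.IsChain (· ≠ ·)

theorem reduced_tail {j : Fin 4} {w : List (Fin 4)} (h : Reduced (j :: w)) : Reduced w := h.tail

/-- The colour of a `3`-cell. -/
def Cell.color : Cell → Fin 4
  | .base i => i
  | .apex j _ _ => j

/-- The word of the tetrahedron that was created together with a `3`-cell. -/
def Cell.birth : Cell → List (Fin 4)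
  | .base _ => []
  | .apex j w _ => j :: w

open Classical in
/-- The vertex of colour `i` of the tetrahedron with word `w`, as a total function. -/
noncomputable def cell (w : List (Fin 4)) (i : Fin 4) : Cell :=
  if h : Reduced w then corner w h i else .base i

theorem cell_eq_corner {w : List (Fin 4)} (h : Reduced w) (i : Fin 4) :
    cell w i = corner w h i := by
  simp [cell, h]

theorem cell_nil (i : Fin 4) : cell [] i = .base i := by
  rw [cell_eq_corner List.isChain_nil]; rfl

theorem cell_cons_self {j : Fin 4} {w : List (Fin 4)} (h : Reduced (j :: w)) :
    cell (j :: w) j = .apex j w h := by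
  rw [cell_eq_corner h]; simp [corner]

theorem cell_cons_of_ne {i j : Fin 4} {w : List (Fin 4)} (h : Reduced (j :: w)) (hij : i ≠ j) :
    cell (j :: w) i = cell w i := by
  rw [cell_eq_corner h, cell_eq_corner (reduced_tail h)]; simp [corner, hij]

theorem color_cell (w : List (Fin 4)) (i : Fin 4) : (cell w i).color = i := by
  by_cases h : Reduced w
  · induction w with
    | nil => rw [cell_nil]; rfl
    | cons j w ih =>
      by_cases hij : i = j
      · subst hij; rw [cell_cons_self h]; rfl
      · rw [cell_cons_of_ne h hij, ih (reduced_tail h)]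
  · simp [cell, h, Cell.color]

theorem cell_injective (w : List (Fin 4)) : Function.Injective (cell w) := fun i j h => by
  rw [← color_cell w i, h, color_cell]

theorem birth_cell_suffix {w : List (Fin 4)} (h : Reduced w) (i : Fin 4) :
    (cell w i).birth <:+ w := by
  induction w with
  | nil => rw [cell_nil]; exact List.suffix_rfl
  | cons j w ih =>
    by_cases hij : i = j
    · subst hij; rw [cell_cons_self h]; exact List.suffix_rfl
    · rw [cell_cons_of_ne h hij]; exact (ih (reduced_tail h)).trans (List.suffix_cons j w)

theorem reduced_birth (X : Cell) : Reduced X.birth := by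
  cases X with
  | base i => exact List.isChain_nil
  | apex j w h => exact h

theorem cell_birth (X : Cell) : cell X.birth X.color = X := by
  cases X with
  | base i => exact cell_nil i
  | apex j w h => exact cell_cons_self h

/-- A cell of a tetrahedron already belongs to all earlier ones after its creation. -/
theorem cell_eq_of_suffix {v w : List (Fin 4)} (hw : Reduced w) (i : Fin 4) (hv : v <:+ w)
    (hb : (cell w i).birth <:+ v) : cell v i = cell w i := by
  induction w with
  | nil => rw [List.suffix_nil.1 hv]
  | cons j w ih =>
    rcases List.suffix_cons_iff.1 hv with rfl | hvw
    · rfl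
    by_cases hij : i = j
    · subst hij
      rw [cell_cons_self hw] at hb
      have := (hb.trans hvw).length_le
      simp [Cell.birth] at this
    · rw [cell_cons_of_ne hw hij] at hb ⊢
      exact ih (reduced_tail hw) hvw hb

/-- The vertices of the tetrahedron with word `w`. -/
noncomputable def tet (w : List (Fin 4)) : Finset Cell := Finset.univ.image (cell w)

/-- The face of the tetrahedron with word `w` opposite to the vertex of colour `j`. -/
noncomputable def face (j : Fin 4) (w : List (Fin 4)) : Finset Cell :=
  (Finset.univ.erase j).image (cell w)

theorem cell_mem_tet (w : List (Fin 4)) (i : Fin 4) : cell w i ∈ tet w :=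
  Finset.mem_image_of_mem _ (Finset.mem_univ i)

theorem mem_tet {w : List (Fin 4)} {X : Cell} : X ∈ tet w ↔ ∃ i, cell w i = X := by
  simp [tet]

theorem mem_face {w : List (Fin 4)} {j : Fin 4} {X : Cell} :
    X ∈ face j w ↔ ∃ i, i ≠ j ∧ cell w i = X := by
  simp [face]

theorem face_subset_tet_self (j : Fin 4) (w : List (Fin 4)) : face j w ⊆ tet w :=
  Finset.image_subset_image (Finset.erase_subset _ _)

theorem face_cons {j : Fin 4} {w : List (Fin 4)} (h : Reduced (j :: w)) :
    face j (j :: w) = face j w :=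
  Finset.image_congr fun _ hi => cell_cons_of_ne h (Finset.ne_of_mem_erase hi)

theorem card_tet (w : List (Fin 4)) : (tet w).card = 4 := by
  rw [tet, Finset.card_image_of_injective _ (cell_injective w)]; rfl

theorem card_face (j : Fin 4) (w : List (Fin 4)) : (face j w).card = 3 := by
  rw [face, Finset.card_image_of_injective _ (cell_injective w)]; simp

theorem cell_notMem_face (j : Fin 4) (w : List (Fin 4)) : cell w j ∉ face j w := by
  rw [mem_face]
  rintro ⟨i, hij, h⟩
  exact hij (cell_injective w h)

theorem insert_cell_face (j : Fin 4) (w : List (Fin 4)) : insert (cell w j) (face j w) = tet w := by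
  rw [face, tet, ← Finset.image_insert, Finset.insert_erase (Finset.mem_univ j)]

theorem meetGraph_adj_cell {w : List (Fin 4)} (h : Reduced w) {i j : Fin 4} (hij : i ≠ j) :
    meetGraph.Adj (cell w i) (cell w j) :=
  ⟨fun h' => hij (cell_injective w h'), w, h, i, j,
    (cell_eq_corner h i).symm, (cell_eq_corner h j).symm⟩

theorem isClique_tet {w : List (Fin 4)} (h : Reduced w) :
    meetGraph.IsClique (tet w : Set Cell) := by
  intro X hX Y hY hXY
  obtain ⟨i, rfl⟩ := mem_tet.1 hX
  obtain ⟨j, rfl⟩ := mem_tet.1 hY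
  exact meetGraph_adj_cell h fun hij => hXY (by rw [hij])

theorem tet_mem_Omega0 {w : List (Fin 4)} (h : Reduced w) : tet w ∈ Omega0 :=
  ⟨isClique_tet h, card_tet w⟩

theorem face_mem_Omega1 (j : Fin 4) {w : List (Fin 4)} (h : Reduced w) : face j w ∈ Omega1 :=
  ⟨(isClique_tet h).subset (Finset.coe_subset.2 (face_subset_tet_self j w)), card_face j w⟩

theorem pair_mem_Omega2 {w : List (Fin 4)} (h : Reduced w) {i j : Fin 4} (hij : i ≠ j) :
    {cell w i, cell w j} ∈ Omega2 := by
  refine ⟨(isClique_tet h).subset ?_, Finset.card_pair fun h' => hij (cell_injective w h')⟩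
  intro X hX
  simp only [Finset.coe_insert, Finset.coe_singleton, Set.mem_insert_iff,
    Set.mem_singleton_iff] at hX
  rcases hX with rfl | rfl
  exacts [cell_mem_tet w i, cell_mem_tet w j]

/-- Every nonempty clique lies in the tetrahedron created with its newest cell. -/
theorem exists_subset_tet_birth {s : Finset Cell} (hs : meetGraph.IsClique (s : Set Cell))
    (hne : s.Nonempty) : ∃ X ∈ s, s ⊆ tet X.birth := by
  obtain ⟨X, hX, hmax⟩ := s.exists_max_image (fun X => X.birth.length) hne
  refine ⟨X, hX, fun Y hY => ?_⟩
  by_cases hXY : X = Y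
  · subst hXY; exact mem_tet.2 ⟨X.color, cell_birth X⟩
  obtain ⟨-, w, hw, i, j, hi, hj⟩ := hs hX hY hXY
  rw [← cell_eq_corner hw] at hi hj
  have h1 : X.birth <:+ w := hi ▸ birth_cell_suffix hw i
  have h2 : Y.birth <:+ w := hj ▸ birth_cell_suffix hw j
  have h3 : Y.birth <:+ X.birth := List.suffix_of_suffix_length_le h2 h1 (hmax Y hY)
  exact mem_tet.2 ⟨j, by rw [cell_eq_of_suffix hw j h1 (by rwa [hj]), hj]⟩

theorem exists_tet_of_mem_Omega0 {s : Finset Cell} (hs : s ∈ Omega0) :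
    ∃ w, Reduced w ∧ s = tet w := by
  obtain ⟨X, -, h⟩ := exists_subset_tet_birth hs.1 (Finset.card_pos.1 (by rw [hs.2]; norm_num))
  exact ⟨X.birth, reduced_birth X, Finset.eq_of_subset_of_card_le h (by rw [card_tet, hs.2])⟩

theorem exists_face_of_mem_Omega1 {s : Finset Cell} (hs : s ∈ Omega1) :
    ∃ j w, Reduced (j :: w) ∧ s = face j w := by
  obtain ⟨X, hX, h⟩ := exists_subset_tet_birth hs.1 (Finset.card_pos.1 (by rw [hs.2]; norm_num))
  obtain ⟨Y, hY, hYs⟩ := Finset.exists_mem_notMem_of_card_lt_card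
    (show s.card < (tet X.birth).card by rw [card_tet, hs.2]; norm_num)
  obtain ⟨j, rfl⟩ := mem_tet.1 hY
  refine ⟨j, X.birth, ?_, Finset.eq_of_subset_of_card_le ?_ (by rw [card_face, hs.2])⟩
  · cases X with
    | base i => exact List.isChain_singleton j
    | apex k w hk =>
      refine List.isChain_cons_cons.2 ⟨?_, hk⟩
      rintro rfl
      rw [Cell.birth, cell_cons_self hk] at hYs
      exact hYs hX
  · intro Z hZ
    obtain ⟨i, rfl⟩ := mem_tet.1 (h hZ)
    exact mem_face.2 ⟨i, fun hij => hYs (hij ▸ hZ), rfl⟩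

/-- A cell which has been replaced does not occur in later tetrahedra. -/
theorem cell_notMem_tet {v w : List (Fin 4)} {k : Fin 4} (hv : Reduced v) {X : Cell}
    (hk : k :: w <:+ v) (hX : X.color = k) (hb : X.birth <:+ w) : X ∉ tet v := by
  intro h
  obtain ⟨i, rfl⟩ := mem_tet.1 h
  rw [color_cell] at hX
  subst hX
  have hk' : Reduced (i :: w) := hv.suffix hk
  have := cell_eq_of_suffix hv i hk (hb.trans (List.suffix_cons i w))
  rw [← this, cell_cons_self hk'] at hb
  have := hb.length_le
  simp [Cell.birth] at this

/-- A face contains the newest cell of `w`, so a tetrahedron containing it must extend `w`. The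
first letter added must be `j`, the only colour whose replacement spares the face, and a second
letter would differ from `j` and destroy it. -/
theorem eq_or_eq_of_face_subset_tet {j : Fin 4} {v w : List (Fin 4)} (hw : Reduced (j :: w))
    (hv : Reduced v) (h : face j w ⊆ tet v) : v = w ∨ v = j :: w := by
  have hwv : w <:+ v := by
    cases w with
    | nil => exact List.nil_suffix
    | cons m w =>
      have hm : cell (m :: w) m ∈ tet v :=
        h (mem_face.2 ⟨m, (List.isChain_cons_cons.1 hw).1.symm, rfl⟩)
      obtain ⟨i, hi⟩ := mem_tet.1 hm
      have := birth_cell_suffix hv i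
      rwa [hi, cell_cons_self (reduced_tail hw)] at this
  have key : ∀ k w', k ≠ j → w <:+ w' → ¬ k :: w' <:+ v := fun k w' hkj hw' hk =>
    cell_notMem_tet hv hk (color_cell w k) ((birth_cell_suffix (reduced_tail hw) k).trans hw')
      (h (mem_face.2 ⟨k, hkj, rfl⟩))
  obtain ⟨l, rfl⟩ := hwv
  rcases List.eq_nil_or_concat l with rfl | ⟨l, k, rfl⟩
  · exact Or.inl rfl
  right
  have hk : k = j := by
    by_contra hk
    exact key k w hk List.suffix_rfl ⟨l, by simp⟩
  subst hk
  rcases List.eq_nil_or_concat l with rfl | ⟨l, m, rfl⟩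
  · rfl
  exfalso
  have hm : m :: k :: w <:+ (l.concat m).concat k ++ w := ⟨l, by simp⟩
  exact key m (k :: w) (List.isChain_cons_cons.1 (hv.suffix hm)).1 (List.suffix_cons k w) hm

theorem tet_injective {v w : List (Fin 4)} (hv : Reduced v) (hw : Reduced w)
    (h : tet v = tet w) : v = w := by
  have key : ∀ {v w : List (Fin 4)}, Reduced v → Reduced w → tet v = tet w → v <:+ w := by
    intro v w hv hw h
    cases v with
    | nil => exact List.nil_suffix
    | cons j v =>
      obtain ⟨i, hi⟩ := mem_tet.1 (h ▸ cell_mem_tet (j :: v) j)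
      have := birth_cell_suffix hw i
      rwa [hi, cell_cons_self hv] at this
  exact (key hv hw h).eq_of_length_le (key hw hv h.symm).length_le

/-- An oriented edge runs between a tetrahedron and one of its successors. -/
theorem IsOrientedEdge.exists_word {t : Finset Cell} {δ' δ : Cell} (h : IsOrientedEdge t δ' δ) :
    ∃ j w, Reduced (j :: w) ∧ t = face j w ∧
      (δ' = cell w j ∧ δ = cell (j :: w) j ∨ δ' = cell (j :: w) j ∧ δ = cell w j) := by
  obtain ⟨ht, hδ't, hδt, hne, h', h⟩ := h
  obtain ⟨j, w, hjw, rfl⟩ := exists_face_of_mem_Omega1 ht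
  have key : ∀ X, X ∉ face j w → insert X (face j w) ∈ Omega0 →
      X = cell w j ∨ X = cell (j :: w) j := by
    intro X hX hX0
    obtain ⟨v, hv, hXv⟩ := exists_tet_of_mem_Omega0 hX0
    have hXm : X ∈ tet v := hXv ▸ Finset.mem_insert_self X _
    rcases eq_or_eq_of_face_subset_tet hjw hv (hXv ▸ Finset.subset_insert X _) with rfl | rfl
    · rw [← insert_cell_face j] at hXm
      exact Or.inl ((Finset.mem_insert.1 hXm).resolve_right hX)
    · rw [← insert_cell_face j, face_cons hjw] at hXm
      exact Or.inr ((Finset.mem_insert.1 hXm).resolve_right hX)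
  refine ⟨j, w, hjw, rfl, ?_⟩
  rcases key δ' hδ't h' with h1 | h1 <;> rcases key δ hδt h with h2 | h2
  · exact absurd (h1.trans h2.symm) hne
  · exact Or.inl ⟨h1, h2⟩
  · exact Or.inr ⟨h1, h2⟩
  · exact absurd (h1.trans h2.symm) hne

theorem insert_cell_cons_face {j : Fin 4} {w : List (Fin 4)} (h : Reduced (j :: w)) :
    insert (cell (j :: w) j) (face j w) = tet (j :: w) := by
  rw [← face_cons h, insert_cell_face]

theorem cell_cons_ne_cell {j : Fin 4} {w : List (Fin 4)} (h : Reduced (j :: w)) (i : Fin 4) :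
    cell (j :: w) j ≠ cell w i := by
  intro h'
  have := (birth_cell_suffix (reduced_tail h) i).length_le
  rw [← h', cell_cons_self h] at this
  simp [Cell.birth] at this

theorem isOrientedEdge_down {j : Fin 4} {w : List (Fin 4)} (h : Reduced (j :: w)) :
    IsOrientedEdge (face j w) (cell w j) (cell (j :: w) j) := by
  refine ⟨face_mem_Omega1 j (reduced_tail h), cell_notMem_face j w, ?_, (cell_cons_ne_cell h j).symm, ?_, ?_⟩
  · rw [← face_cons h]; exact cell_notMem_face j _
  · rw [insert_cell_face]; exact tet_mem_Omega0 (reduced_tail h)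
  · rw [insert_cell_cons_face h]; exact tet_mem_Omega0 h

theorem IsOrientedEdge.symm {t : Finset Cell} {δ' δ : Cell} (h : IsOrientedEdge t δ' δ) :
    IsOrientedEdge t δ δ' :=
  ⟨h.1, h.2.2.1, h.2.1, h.2.2.2.1.symm, h.2.2.2.2.2, h.2.2.2.2.1⟩

/-! ### Distances in the skeleton -/

theorem skeleton_adj_cons {j : Fin 4} {w : List (Fin 4)} (h : Reduced (j :: w)) :
    skeleton.Adj (tet w) (tet (j :: w)) := by
  refine ⟨tet_mem_Omega0 (reduced_tail h), tet_mem_Omega0 h, fun h' => ?_, face j w,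
    face_mem_Omega1 j (reduced_tail h), face_subset_tet_self j w, ?_⟩
  · have := tet_injective (reduced_tail h) h h'
    simp at this
  · rw [← face_cons h]; exact face_subset_tet_self j _

theorem skeleton_adj_tet {v w : List (Fin 4)} (hv : Reduced v) (hw : Reduced w)
    (h : skeleton.Adj (tet v) (tet w)) : ∃ j, w = j :: v ∨ v = j :: w := by
  obtain ⟨-, -, hne, t, ht, htv, htw⟩ := h
  obtain ⟨j, u, hju, rfl⟩ := exists_face_of_mem_Omega1 ht
  rcases eq_or_eq_of_face_subset_tet hju hv htv with rfl | rfl <;>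
    rcases eq_or_eq_of_face_subset_tet hju hw htw with rfl | rfl
  · exact absurd rfl hne
  · exact ⟨j, Or.inl rfl⟩
  · exact ⟨j, Or.inr rfl⟩
  · exact absurd rfl hne

theorem reachable_tet {v w : List (Fin 4)} (hv : Reduced v) (hw : Reduced w) :
    skeleton.Reachable (tet v) (tet w) := by
  have key : ∀ {w : List (Fin 4)}, Reduced w → skeleton.Reachable (tet []) (tet w) := by
    intro w hw
    induction w with
    | nil => exact SimpleGraph.Reachable.refl _
    | cons j w ih => exact (ih (reduced_tail hw)).trans (skeleton_adj_cons hw).reachable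
  exact (key hv).symm.trans (key hw)

/-- If the only edge of a graph that leaves `S` starts at `p`, a walk that leaves `S` is longer than
the distance of its start from `p`. -/
theorem _root_.SimpleGraph.Walk.dist_lt_length_of_unique_exit {V : Type*} {G : SimpleGraph V}
    {S : Set V} {p : V} (hS : ∀ a b, G.Adj a b → a ∈ S → b ∉ S → a = p) {x y : V}
    (W : G.Walk x y) (hx : x ∈ S) (hy : y ∉ S) : G.dist x p < W.length := by
  suffices ∃ W' : G.Walk x p, W'.length < W.length by
    obtain ⟨W', h⟩ := this
    exact (SimpleGraph.dist_le W').trans_lt h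
  induction W with
  | nil => exact absurd hx hy
  | @cons a b c hab W ih =>
    by_cases hb : b ∈ S
    · obtain ⟨W', h⟩ := ih hb hy
      exact ⟨.cons hab W', by simpa using h⟩
    · obtain rfl := hS a b hab hx hb
      exact ⟨.nil, by simp⟩

/-- The words that extend `j :: w` form a branch of the tree whose only exit is the edge from `j ::
w` to `w`. Every walk from inside the branch to `w` has to use it. -/
theorem dist_lt_of_suffix {j : Fin 4} {u w : List (Fin 4)} (hu : Reduced u)
    (h : j :: w <:+ u) : skeleton.dist (tet u) (tet (j :: w)) < skeleton.dist (tet u) (tet w) := by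
  have hjw : Reduced (j :: w) := hu.suffix h
  obtain ⟨W, hW⟩ := (reachable_tet hu (reduced_tail hjw)).exists_walk_length_eq_dist
  rw [← hW]
  refine W.dist_lt_length_of_unique_exit (S := {s | ∃ v, Reduced v ∧ j :: w <:+ v ∧ s = tet v})
    ?_ ⟨u, hu, h, rfl⟩ ?_
  · rintro _ b hab ⟨v, hv, hjv, rfl⟩ hb
    obtain ⟨v', hv', rfl⟩ := exists_tet_of_mem_Omega0 hab.2.1
    have hn : ¬ j :: w <:+ v' := fun h' => hb ⟨v', hv', h', rfl⟩
    obtain ⟨k, rfl | rfl⟩ := skeleton_adj_tet hv hv' hab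
    · exact absurd (hjv.trans (List.suffix_cons k v)) hn
    · rw [(List.suffix_cons_iff.1 hjv).resolve_right hn]
  · rintro ⟨v, hv, hjv, h'⟩
    rw [← tet_injective (reduced_tail hjw) hv h'] at hjv
    have := hjv.length_le
    simp at this

/-- The same cut seen from the complement of the branch, whose only exit starts at `w`. -/
theorem dist_lt_of_not_suffix {j : Fin 4} {u w : List (Fin 4)} (hu : Reduced u)
    (hjw : Reduced (j :: w)) (h : ¬ j :: w <:+ u) :
    skeleton.dist (tet u) (tet w) < skeleton.dist (tet u) (tet (j :: w)) := by
  obtain ⟨W, hW⟩ := (reachable_tet hu hjw).exists_walk_length_eq_dist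
  rw [← hW]
  refine W.dist_lt_length_of_unique_exit
    (S := {s | ∀ v, Reduced v → s = tet v → ¬ j :: w <:+ v}) ?_ ?_ ?_
  · rintro a b hab ha hb
    obtain ⟨v, hv, rfl⟩ := exists_tet_of_mem_Omega0 hab.1
    simp only [Set.mem_ofPred_eq, not_forall, not_not] at hb
    obtain ⟨v', hv', rfl, hs⟩ := hb
    have hn := ha v hv rfl
    obtain ⟨k, rfl | rfl⟩ := skeleton_adj_tet hv hv' hab
    · rcases List.suffix_cons_iff.1 hs with h1 | h1
      · obtain ⟨rfl, rfl⟩ := List.cons_eq_cons.1 h1; rfl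
      · exact absurd h1 hn
    · exact absurd (hs.trans (List.suffix_cons k v')) hn
  · intro v hv huv
    rwa [← tet_injective hu hv huv]
  · intro h'
    exact h' _ hjw rfl List.suffix_rfl

/-! ### The analytic estimate at a fork -/

/-- Two `x, y` with `|S - x| ≤ |x|`, `|S - y| ≤ |y|`, where `S = a + b + x + y ≠ 0`
and `S² = abxy`, are bounded in terms of `a, b` unless `ab ∈ [0, 4]`. -/
theorem exists_bound_of_fork {a b : ℂ} (hab : ∀ r ∈ Set.Icc (0 : ℝ) 4, a * b ≠ r) :
    ∃ K : ℝ, ∀ x y : ℂ, (a + b + x + y) ^ 2 = a * b * x * y → a + b + x + y ≠ 0 →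
      ‖a + b + x + y - x‖ ≤ ‖x‖ → ‖a + b + x + y - y‖ ≤ ‖y‖ → ‖x * y‖ ≤ K := by
  have hab0 : a * b ≠ 0 := by simpa using hab 0 (by simp)
  set q : ℂ := 1 / (a * b) with hq
  have hq0 : q ≠ 0 := one_div_ne_zero hab0
  -- The hypothesis says that `q = 1/(ab)` is not in `[1/4, ∞)`. This is made quantitative: `δ` is
  -- so small that `q` is not even close to this ray, with the error terms that come up at the end.
  obtain ⟨δ, hδ, hδq⟩ : ∃ δ : ℝ, 0 < δ ∧ ¬ (|q.im| ≤ δ * (1 / 2 + 4 * ‖q‖) ∧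
      1 / 4 ≤ q.re + 2 * ‖q‖ * δ) := by
    by_cases him : q.im = 0
    · have hre : q.re < 1 / 4 := by
        by_contra! h
        refine hab (1 / q.re) ⟨by positivity, ?_⟩ ?_
        · rw [div_le_iff₀ (by linarith)]; linarith
        · have : q = (q.re : ℂ) := Complex.ext (by simp) (by simp [him])
          rw [Complex.ofReal_div, ← this, hq]; simp
      have hq' : 0 < ‖q‖ := norm_pos_iff.2 hq0
      refine ⟨(1 / 4 - q.re) / (4 * ‖q‖), div_pos (by linarith) (by positivity), fun h => ?_⟩
      have := h.2
      have e : 2 * ‖q‖ * ((1 / 4 - q.re) / (4 * ‖q‖)) = (1 / 4 - q.re) / 2 := by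
        field_simp; ring
      linarith
    · have him' : 0 < |q.im| := abs_pos.2 him
      have hq' : 0 ≤ ‖q‖ := norm_nonneg q
      refine ⟨|q.im| / (1 + 8 * ‖q‖) , by positivity, fun h => ?_⟩
      have := h.1
      have e : |q.im| / (1 + 8 * ‖q‖) * (1 / 2 + 4 * ‖q‖) = |q.im| / 2 := by
        field_simp; ring
      linarith
  refine ⟨‖q‖ * (‖a + b‖ / δ) ^ 2, fun x y hS hS0 hx hy => ?_⟩
  set S := a + b + x + y with hSdef
  have hxy : x * y = q * S ^ 2 := by
    rw [hS, hq, one_div, mul_assoc (a * b), inv_mul_cancel_left₀ hab0]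
  suffices h : ‖S‖ ≤ ‖a + b‖ / δ by
    rw [hxy, norm_mul, norm_pow]; gcongr
  rw [le_div_iff₀ hδ]
  -- If `S` were large, then `p = x/S` and `r = y/S` would have real parts at least `1/2` and sum
  -- nearly `1`. So nearly `p = 1/2 + it`, `r = 1/2 - it`, and `q = pr` would be close to `1/4 +
  -- t²`, on the excluded ray.
  by_contra! hlt
  set p := x / S with hp
  set r := y / S with hr
  set ε := (a + b) / S with hε
  have hSn : 0 < ‖S‖ := norm_pos_iff.2 hS0
  have hεδ : ‖ε‖ ≤ δ := by
    rw [hε, norm_div, div_le_iff₀ hSn]; linarith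
  have hsum : p + r + ε = 1 := by
    rw [hp, hr, hε]; field_simp; rw [hSdef]; ring
  have hpr : p * r = q := by
    rw [hp, hr, div_mul_div_comm, hxy]; field_simp
  -- After division by `S` the condition reads `|1 - z| ≤ |z|`, a half-plane.
  have half : ∀ z : ℂ, ‖S - z‖ ≤ ‖z‖ → 1 / 2 ≤ (z / S).re := by
    intro z hz
    have h1 : ‖1 - z / S‖ ≤ ‖z / S‖ := by
      have : 1 - z / S = (S - z) / S := by field_simp
      rw [this, norm_div, norm_div]; gcongr
    have h2 : ‖1 - z / S‖ ^ 2 ≤ ‖z / S‖ ^ 2 := by gcongr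
    rw [← Complex.normSq_eq_norm_sq, ← Complex.normSq_eq_norm_sq, Complex.normSq_apply,
      Complex.normSq_apply] at h2
    simp only [Complex.sub_re, Complex.one_re, Complex.sub_im, Complex.one_im] at h2
    nlinarith
  have hpre := half x hx
  have hrre := half y hy
  rw [← hp] at hpre
  rw [← hr] at hrre
  have hre : p.re + r.re + ε.re = 1 := by simpa using congrArg Complex.re hsum
  have him : p.im + r.im + ε.im = 0 := by simpa using congrArg Complex.im hsum
  have hqre : q.re = p.re * r.re - p.im * r.im := by rw [← hpr, Complex.mul_re]
  have hqim : q.im = p.re * r.im + p.im * r.re := by rw [← hpr, Complex.mul_im]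
  have hqn : ‖q‖ = ‖p‖ * ‖r‖ := by rw [← hpr, norm_mul]
  have hεre := abs_le.1 ((Complex.abs_re_le_norm ε).trans hεδ)
  have hεim := abs_le.1 ((Complex.abs_im_le_norm ε).trans hεδ)
  have hpn : 1 / 2 ≤ ‖p‖ := hpre.trans (Complex.re_le_norm p)
  have hrn : 1 / 2 ≤ ‖r‖ := hrre.trans (Complex.re_le_norm r)
  -- Each factor of `q = pr` has modulus at least `1/2`, which bounds the other; so the errors are
  -- linear in `δ` with constants depending on `q` alone.
  have hpq : ‖p‖ ≤ 2 * ‖q‖ := by nlinarith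
  have hrq : ‖r‖ ≤ 2 * ‖q‖ := by nlinarith
  have aux : ∀ u t : ℝ, |u| ≤ 2 * ‖q‖ → |t| ≤ δ → |u * t| ≤ 2 * ‖q‖ * δ := fun u t hu ht => by
    rw [abs_mul]; gcongr
  have hpi2 : |p.im| ≤ 2 * ‖q‖ := (Complex.abs_im_le_norm p).trans hpq
  have hri2 : |r.im| ≤ 2 * ‖q‖ := (Complex.abs_im_le_norm r).trans hrq
  apply hδq
  constructor
  · have h1 := abs_le.1 (aux r.im (p.re - 1 / 2) hri2 (abs_le.2 ⟨by linarith, by linarith⟩))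
    have h2 := abs_le.1 (aux p.im (r.re - 1 / 2) hpi2 (abs_le.2 ⟨by linarith, by linarith⟩))
    rw [abs_le]
    constructor <;> nlinarith
  · have h1 := abs_le.1 (aux p.im ε.im hpi2 ((Complex.abs_im_le_norm ε).trans hεδ))
    have h3 : r.im = - p.im - ε.im := by linarith
    rw [hqre, h3]
    nlinarith [mul_nonneg (sub_nonneg.2 hpre) (sub_nonneg.2 hrre), sq_nonneg p.im]

/-! ### BQ maps on words: finitely many descents -/

/-- Values on the vertices of the tree of reduced words, one for each colour, which behave like
those of a BQ-Markoff map. -/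
structure IsBQWordMap (v : List (Fin 4) → Fin 4 → ℂ) : Prop where
  keep : ∀ {j w}, Reduced (j :: w) → ∀ {i}, i ≠ j → v (j :: w) i = v w i
  vertex : ∀ {w}, Reduced w → (∑ i, v w i) ^ 2 = ∏ i, v w i
  edge : ∀ {j w}, Reduced (j :: w) →
    v (j :: w) j + v w j + 2 * ∑ i ∈ Finset.univ.erase j, v w i = ∏ i ∈ Finset.univ.erase j, v w i
  mul_ne : ∀ {w}, Reduced w → ∀ {i j}, i ≠ j → ∀ r ∈ Set.Icc (0 : ℝ) 4, v w i * v w j ≠ r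
  finite : ∀ K : ℝ, {u | Reduced u ∧ ∃ j w, u = j :: w ∧ ∃ i, i ≠ j ∧ ‖v u j * v u i‖ ≤ K}.Finite


theorem Fin.exists_ne_ne {i j : Fin 4} (h : i ≠ j) :
    ∃ k l, k ≠ i ∧ k ≠ j ∧ l ≠ i ∧ l ≠ j ∧ k ≠ l := by
  revert i j; decide

theorem Fin.erase_eq {i j k l : Fin 4} (hij : i ≠ j) (hik : k ≠ i) (hjk : k ≠ j) (hil : l ≠ i)
    (hjl : l ≠ j) (hkl : k ≠ l) : Finset.univ.erase i = {j, k, l} := by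
  revert i j k l; decide

theorem Fin.sum_erase_eq {M : Type*} [AddCommMonoid M] (f : Fin 4 → M) {i j k l : Fin 4}
    (hij : i ≠ j) (hik : k ≠ i) (hjk : k ≠ j) (hil : l ≠ i) (hjl : l ≠ j) (hkl : k ≠ l) :
    ∑ x ∈ Finset.univ.erase i, f x = f j + (f k + f l) := by
  rw [Fin.erase_eq hij hik hjk hil hjl hkl, Finset.sum_insert (by simp [hjk.symm, hjl.symm]),
    Finset.sum_pair hkl]

theorem Fin.prod_erase_eq {M : Type*} [CommMonoid M] (f : Fin 4 → M) {i j k l : Fin 4}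
    (hij : i ≠ j) (hik : k ≠ i) (hjk : k ≠ j) (hil : l ≠ i) (hjl : l ≠ j) (hkl : k ≠ l) :
    ∏ x ∈ Finset.univ.erase i, f x = f j * (f k * f l) := by
  rw [Fin.erase_eq hij hik hjk hil hjl hkl, Finset.prod_insert (by simp [hjk.symm, hjl.symm]),
    Finset.prod_pair hkl]

namespace IsBQWordMap

variable {v : List (Fin 4) → Fin 4 → ℂ}

theorem ne_zero (hv : IsBQWordMap v) {w} (hw : Reduced w) (i : Fin 4) : v w i ≠ 0 := by
  obtain ⟨j, hj⟩ := exists_ne i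
  have := hv.mul_ne hw hj 0 (by simp)
  intro h
  simp [h] at this

theorem sum_keep (hv : IsBQWordMap v) {j w} (h : Reduced (j :: w)) :
    ∑ i ∈ Finset.univ.erase j, v (j :: w) i = ∑ i ∈ Finset.univ.erase j, v w i :=
  Finset.sum_congr rfl fun _ hi => hv.keep h (Finset.ne_of_mem_erase hi)

theorem prod_keep (hv : IsBQWordMap v) {j w} (h : Reduced (j :: w)) :
    ∏ i ∈ Finset.univ.erase j, v (j :: w) i = ∏ i ∈ Finset.univ.erase j, v w i :=
  Finset.prod_congr rfl fun _ hi => hv.keep h (Finset.ne_of_mem_erase hi)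

theorem vertex_erase (hv : IsBQWordMap v) {w} (hw : Reduced w) (j : Fin 4) :
    (v w j + ∑ i ∈ Finset.univ.erase j, v w i) ^ 2 =
      v w j * ∏ i ∈ Finset.univ.erase j, v w i := by
  rw [Finset.add_sum_erase _ _ (Finset.mem_univ j), Finset.mul_prod_erase _ _ (Finset.mem_univ j),
    hv.vertex hw]

/-- Vieta: the old and the new value are the two roots of the vertex relation, a quadratic with
constant term the square of the sum of the other three. -/
theorem mul_flip (hv : IsBQWordMap v) {j w} (h : Reduced (j :: w)) :
    v (j :: w) j * v w j = (∑ i ∈ Finset.univ.erase j, v w i) ^ 2 := by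
  have h1 := hv.edge h
  have h2 := hv.vertex_erase (reduced_tail h) j
  rw [← h1] at h2
  linear_combination -h2

theorem norm_sum_le_of_le (hv : IsBQWordMap v) {j w} (h : Reduced (j :: w))
    (hle : ‖v w j‖ ≤ ‖v (j :: w) j‖) :
    ‖∑ i ∈ Finset.univ.erase j, v w i‖ ≤ ‖v (j :: w) j‖ := by
  have := congrArg norm (hv.mul_flip h)
  rw [norm_mul, norm_pow] at this
  refine le_of_sq_le_sq ?_ (norm_nonneg _)
  rw [← this, sq]; gcongr

theorem norm_sum_le_of_ge (hv : IsBQWordMap v) {j w} (h : Reduced (j :: w))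
    (hle : ‖v (j :: w) j‖ ≤ ‖v w j‖) :
    ‖∑ i ∈ Finset.univ.erase j, v w i‖ ≤ ‖v w j‖ := by
  have := congrArg norm (hv.mul_flip h)
  rw [norm_mul, norm_pow] at this
  refine le_of_sq_le_sq ?_ (norm_nonneg _)
  rw [← this, sq]; gcongr

/-- By `mul_flip` the larger root `d` satisfies `|E| ≤ |d|`, so the vertex relation `(d + E)² = dP`
gives `|d||P| ≤ (2|d|)²`. This is the source of superadditivity. -/
theorem norm_prod_le (hv : IsBQWordMap v) {j w} (h : Reduced (j :: w))
    (hle : ‖v w j‖ ≤ ‖v (j :: w) j‖) :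
    ‖∏ i ∈ Finset.univ.erase j, v w i‖ ≤ 4 * ‖v (j :: w) j‖ := by
  have h1 := congrArg norm (hv.vertex_erase h j)
  rw [hv.sum_keep h, hv.prod_keep h, norm_mul, norm_pow] at h1
  have h2 := norm_add_le (v (j :: w) j) (∑ i ∈ Finset.univ.erase j, v w i)
  have h3 := hv.norm_sum_le_of_le h hle
  have h4 : 0 < ‖v (j :: w) j‖ := norm_pos_iff.2 (hv.ne_zero h j)
  have h5 : ‖v (j :: w) j + ∑ i ∈ Finset.univ.erase j, v w i‖ ^ 2 ≤ (2 * ‖v (j :: w) j‖) ^ 2 := by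
    gcongr; linarith
  rw [h1] at h5
  refine le_of_mul_le_mul_left ?_ h4
  linarith

theorem norm_le (hv : IsBQWordMap v) {w} (hw : Reduced w) (j : Fin 4) :
    ‖v w j‖ ≤ ‖∏ i ∈ Finset.univ.erase j, v w i‖ + 3 * ‖∑ i ∈ Finset.univ.erase j, v w i‖ := by
  set d := v w j
  set E := ∑ i ∈ Finset.univ.erase j, v w i
  set P := ∏ i ∈ Finset.univ.erase j, v w i
  have h : d * d = d * (P - 2 * E) - E ^ 2 := by
    have : (d + E) ^ 2 = d * P := hv.vertex_erase hw j
    linear_combination this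
  have h1 : ‖d‖ * ‖d‖ ≤ ‖d‖ * (‖P‖ + 2 * ‖E‖) + ‖E‖ ^ 2 := by
    calc ‖d‖ * ‖d‖ = ‖d * (P - 2 * E) - E ^ 2‖ := by rw [← h, norm_mul]
      _ ≤ ‖d * (P - 2 * E)‖ + ‖E ^ 2‖ := norm_sub_le _ _
      _ ≤ _ := by
        rw [norm_mul, norm_pow]
        gcongr
        refine (norm_sub_le _ _).trans ?_
        simp
  by_contra! hlt
  have := norm_nonneg P
  have := norm_nonneg E
  nlinarith

/-- At a tetrahedron with a fork, i.e. where two values do not increase when they are replaced, the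
other two have a product of modulus at most `4`. -/
theorem norm_mul_le_four (hv : IsBQWordMap v) {w} (hw : Reduced w) {j k a b : Fin 4}
    (hjk : j ≠ k) (haj : a ≠ j) (hak : a ≠ k) (hbj : b ≠ j) (hbk : b ≠ k) (hab : a ≠ b)
    (hj : ‖∑ i ∈ Finset.univ.erase j, v w i‖ ≤ ‖v w j‖)
    (hk : ‖∑ i ∈ Finset.univ.erase k, v w i‖ ≤ ‖v w k‖) : ‖v w a * v w b‖ ≤ 4 := by
  have hs : ∀ j, ‖∑ i ∈ Finset.univ.erase j, v w i‖ ≤ ‖v w j‖ → ‖∑ i, v w i‖ ≤ 2 * ‖v w j‖ := by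
    intro j hj
    rw [← Finset.add_sum_erase _ _ (Finset.mem_univ j)]
    exact (norm_add_le _ _).trans (by linarith)
  have h1 : ‖∑ i, v w i‖ ^ 2 ≤ (2 * ‖v w j‖) * (2 * ‖v w k‖) := by
    rw [sq]
    exact mul_le_mul (hs j hj) (hs k hk) (norm_nonneg _) (by positivity)
  rw [← norm_pow, hv.vertex hw, ← Finset.mul_prod_erase _ _ (Finset.mem_univ j),
    Fin.prod_erase_eq _ hjk haj hak hbj hbk hab, norm_mul, norm_mul] at h1
  have h2 : 0 < ‖v w j‖ * ‖v w k‖ :=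
    mul_pos (norm_pos_iff.2 (hv.ne_zero hw j)) (norm_pos_iff.2 (hv.ne_zero hw k))
  refine le_of_mul_le_mul_left ?_ h2
  linarith

/-- The words which create a pair of values whose product has modulus at most `K`. -/
def smallWords (v : List (Fin 4) → Fin 4 → ℂ) (K : ℝ) : Set (List (Fin 4)) :=
  {u | Reduced u ∧ ∃ j w, u = j :: w ∧ ∃ i, i ≠ j ∧ ‖v u j * v u i‖ ≤ K}

/-- Going back to the word where the newer of the two cells was created turns infinitely many
tetrahedra around one pair into a single word of a finite set. -/
theorem exists_birth_of_pair (hv : IsBQWordMap v) {w} (hw : Reduced w) {a b : Fin 4} (hab : a ≠ b)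
    {K : ℝ} (h : ‖v w a * v w b‖ ≤ K) :
    ∃ u ∈ insert [] (smallWords v K), v u a = v w a ∧ v u b = v w b := by
  induction w with
  | nil => exact ⟨[], Set.mem_insert _ _, rfl, rfl⟩
  | cons k w ih =>
    by_cases hka : a = k
    · subst hka
      exact ⟨a :: w, Or.inr ⟨hw, a, w, rfl, b, hab.symm, h⟩, rfl, rfl⟩
    by_cases hkb : b = k
    · subst hkb
      exact ⟨b :: w, Or.inr ⟨hw, b, w, rfl, a, hab, by rwa [mul_comm]⟩, rfl, rfl⟩
    rw [hv.keep hw hka, hv.keep hw hkb] at h ⊢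
    exact ih (reduced_tail hw) h

/-- `exists_bound_of_fork` has a constant depending on the pair `a, b`. It becomes uniform because
`norm_mul_le_four` confines the pair to the finitely many with product of modulus at most `4`. -/
theorem exists_fork_bound (hv : IsBQWordMap v) : ∃ K : ℝ, ∀ w, Reduced w → ∀ j k, j ≠ k →
    ‖∑ i ∈ Finset.univ.erase j, v w i‖ ≤ ‖v w j‖ →
    ‖∑ i ∈ Finset.univ.erase k, v w i‖ ≤ ‖v w k‖ → ‖v w j * v w k‖ ≤ K := by
  have hfin : (insert [] (smallWords v 4)).Finite := (hv.finite 4).insert []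
  have hred : ∀ u ∈ insert [] (smallWords v 4), Reduced u := by
    rintro u (rfl | hu)
    exacts [List.isChain_nil, hu.1]
  have hex : ∀ (u : List (Fin 4)) (a b : Fin 4), ∃ K : ℝ, Reduced u → a ≠ b →
      ∀ x y : ℂ, (v u a + v u b + x + y) ^ 2 = v u a * v u b * x * y →
      v u a + v u b + x + y ≠ 0 → ‖v u a + v u b + x + y - x‖ ≤ ‖x‖ →
      ‖v u a + v u b + x + y - y‖ ≤ ‖y‖ → ‖x * y‖ ≤ K := by
    intro u a b
    by_cases h : Reduced u ∧ a ≠ b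
    · obtain ⟨K, hK⟩ := exists_bound_of_fork (hv.mul_ne h.1 h.2)
      exact ⟨K, fun _ _ => hK⟩
    · exact ⟨0, fun h1 h2 => absurd ⟨h1, h2⟩ h⟩
  choose K hK using hex
  obtain ⟨M, hM⟩ := ((hfin.prod (Set.finite_univ (α := Fin 4 × Fin 4))).image
    fun p => K p.1 p.2.1 p.2.2).bddAbove
  refine ⟨M, fun w hw j k hjk hj hk => ?_⟩
  obtain ⟨a, b, haj, hak, hbj, hbk, hab⟩ := Fin.exists_ne_ne hjk
  obtain ⟨u, hu, hua, hub⟩ := hv.exists_birth_of_pair hw hab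
    (hv.norm_mul_le_four hw hjk haj hak hbj hbk hab hj hk)
  have hej : ∑ i ∈ Finset.univ.erase j, v w i = v w k + (v w a + v w b) :=
    Fin.sum_erase_eq _ hjk haj hak hbj hbk hab
  have hek : ∑ i ∈ Finset.univ.erase k, v w i = v w j + (v w a + v w b) :=
    Fin.sum_erase_eq _ hjk.symm hak haj hbk hbj hab
  have hp : ∏ i ∈ Finset.univ.erase j, v w i = v w k * (v w a * v w b) :=
    Fin.prod_erase_eq _ hjk haj hak hbj hbk hab
  have hS := hv.vertex_erase hw j
  rw [hej, hp] at hS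
  rw [hej] at hj
  rw [hek] at hk
  refine (hK u a b (hred u hu) hab (v w j) (v w k) ?_ ?_ ?_ ?_).trans
    (hM ⟨(u, a, b), ⟨hu, trivial⟩, rfl⟩)
  · rw [hua, hub]; linear_combination hS
  · rw [hua, hub]
    intro h0
    have h1 : (v w j + (v w k + (v w a + v w b))) ^ 2 = 0 := by
      rw [show v w j + (v w k + (v w a + v w b)) = 0 by linear_combination h0]; simp
    rw [hS] at h1
    simp [hv.ne_zero hw] at h1
  · rw [hua, hub]; convert hj using 2; ring
  · rw [hua, hub]; convert hk using 2; ring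

/-- Only finitely many new values are smaller than the values that they replace. -/
theorem finite_decreasing (hv : IsBQWordMap v) :
    {u | Reduced u ∧ ∃ j w, u = j :: w ∧ ‖v u j‖ < ‖v w j‖}.Finite := by
  obtain ⟨K, hK⟩ := hv.exists_fork_bound
  have hfin : (insert [] (smallWords v K)).Finite := (hv.finite K).insert []
  obtain ⟨M, hM⟩ := ((hfin.prod (Set.finite_univ (α := Fin 4))).image
    fun p => ‖v p.1 p.2‖).bddAbove
  have hbound : ∀ u ∈ insert [] (smallWords v K), ∀ i, ‖v u i‖ ≤ M := fun u hu i =>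
    hM ⟨(u, i), ⟨hu, trivial⟩, rfl⟩
  -- Follow a chain of descents back to its start. Either that is the root, or an ascent came before
  -- it; then the newest value and the one about to fall form a fork, and `hK` puts the word in a
  -- finite set. Along the chain values only decrease, so `M` bounds them all.
  have key : ∀ w, Reduced w → ∀ j, Reduced (j :: w) → ‖v (j :: w) j‖ < ‖v w j‖ →
      ∀ i, ‖v w i‖ ≤ M := by
    intro w
    induction w with
    | nil => exact fun _ _ _ _ => hbound [] (Set.mem_insert _ _)
    | cons k w ih =>
      intro hw j hj hlt
      have hjk : j ≠ k := (List.isChain_cons_cons.1 hj).1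
      rcases le_or_gt ‖v w k‖ ‖v (k :: w) k‖ with hle | hgt
      · refine hbound _ (Or.inr ⟨hw, k, w, rfl, j, hjk, hK _ hw k j hjk.symm ?_ ?_⟩)
        · rw [hv.sum_keep hw]; exact hv.norm_sum_le_of_le hw hle
        · exact hv.norm_sum_le_of_ge hj hlt.le
      · have hwM := ih (reduced_tail hw) k hw hgt
        intro i
        by_cases hik : i = k
        · subst hik; exact hgt.le.trans (hwM i)
        · rw [hv.keep hw hik]; exact hwM i
  refine (hv.finite (M * M)).subset ?_
  rintro _ ⟨hu, j, w, rfl, hlt⟩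
  obtain ⟨i, hi⟩ := exists_ne j
  have hwM := key w (reduced_tail hu) j hu hlt
  refine ⟨hu, j, w, rfl, i, hi, ?_⟩
  rw [norm_mul, hv.keep hu hi]
  exact mul_le_mul (hlt.le.trans (hwM j)) (hwM i) (norm_nonneg _) ((norm_nonneg _).trans (hwM j))

end IsBQWordMap

/-! ### Superadditive functions against Fibonacci functions -/

open Filter

theorem exists_pos_le_of_finite {α : Type*} {s : Set α} (hs : s.Finite) {f : α → ℝ}
    (hf : ∀ a ∈ s, 0 < f a) : ∃ ε > 0, ∀ a ∈ s, ε ≤ f a := by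
  induction s, hs using Set.Finite.induction_on with
  | empty => exact ⟨1, one_pos, by simp⟩
  | @insert a s _ _ ih =>
    obtain ⟨ε, hε, h⟩ := ih fun b hb => hf b (Or.inr hb)
    refine ⟨min ε (f a), lt_min hε (hf a (Or.inl rfl)), ?_⟩
    rintro b (rfl | hb)
    exacts [min_le_right _ _, (min_le_left _ _).trans (h b hb)]

/-- A sequence of at least linear growth dominates one of at most linear growth. -/
theorem exists_pos_eventually_mul_le {f g : ℕ → ℝ} {c C A B : ℝ} (hc : 0 < c)
    (hf : ∀ᶠ n : ℕ in atTop, c * n - C ≤ f n) (hg : ∀ n : ℕ, g n ≤ A * n + B) :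
    ∃ κ > 0, ∀ᶠ n in atTop, κ * g n ≤ f n := by
  have hD : 0 < |A| + |B| + 1 := by positivity
  refine ⟨c / (2 * (|A| + |B| + 1)), by positivity, ?_⟩
  filter_upwards [hf, eventually_ge_atTop 1, eventually_ge_atTop ⌈2 * C / c⌉₊] with n h1 h2 h3
  have hn : (1 : ℝ) ≤ n := by exact_mod_cast h2
  have h4 : 2 * C / c ≤ n := Nat.ceil_le.1 h3
  rw [div_le_iff₀ hc] at h4
  have h5 : g n ≤ (|A| + |B| + 1) * n := by
    have := mul_le_mul_of_nonneg_right (le_abs_self A) (by linarith : (0 : ℝ) ≤ n)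
    have := mul_le_mul_of_nonneg_left hn (abs_nonneg B)
    have := le_abs_self B
    linarith [hg n]
  calc c / (2 * (|A| + |B| + 1)) * g n ≤ c / (2 * (|A| + |B| + 1)) * ((|A| + |B| + 1) * n) := by
        gcongr
    _ = c * n / 2 := by field_simp
    _ ≤ f n := by linarith

/-- Positivity covers the finitely many indices before the asymptotic bound sets in, at the cost of
a smaller `κ`. -/
theorem exists_pos_mul_le {f g : ℕ → ℝ} {m : ℕ} (hf : ∀ n ≥ m, 0 < f n) (hg : ∀ n, 0 < g n)
    (h : ∃ κ > 0, ∀ᶠ n in atTop, κ * g n ≤ f n) : ∃ κ > 0, ∀ n ≥ m, κ * g n ≤ f n := by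
  obtain ⟨κ, hκ, h⟩ := h
  obtain ⟨n₀, hn₀⟩ := eventually_atTop.1 h
  obtain ⟨ε, hε, hle⟩ := exists_pos_le_of_finite (Set.finite_Ico m n₀)
    (f := fun n => f n / g n) fun n hn => div_pos (hf n hn.1) (hg n)
  refine ⟨min κ ε, lt_min hκ hε, fun n hn => ?_⟩
  rcases lt_or_ge n n₀ with h1 | h1
  · have := hle n ⟨hn, h1⟩
    rw [le_div_iff₀ (hg n)] at this
    exact (mul_le_mul_of_nonneg_right (min_le_right _ _) (hg n).le).trans this
  · exact (mul_le_mul_of_nonneg_right (min_le_left _ _) (hg n).le).trans (hn₀ n h1)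

/-- The letters of an alternating word. -/
def alt (i j : Fin 4) (n : ℕ) : Fin 4 := if Even n then i else j

/-- The words that extend `w` alternatingly by the letters `i` and `j`. -/
def line (w : List (Fin 4)) (i j : Fin 4) : ℕ → List (Fin 4)
  | 0 => w
  | n + 1 => alt i j n :: line w i j n

theorem alt_add_two (i j : Fin 4) (n : ℕ) : alt i j (n + 2) = alt i j n := by
  simp [alt, Nat.even_add]

theorem alt_succ_ne {i j : Fin 4} (h : i ≠ j) (n : ℕ) : alt i j (n + 1) ≠ alt i j n := by
  by_cases hn : Even n <;> simp [alt, Nat.even_add_one, hn, h, h.symm]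

theorem alt_ne {i j k : Fin 4} (hi : k ≠ i) (hj : k ≠ j) (n : ℕ) : k ≠ alt i j n := by
  unfold alt; split_ifs <;> assumption

theorem eq_alt_or {i j k : Fin 4} (h : k = i ∨ k = j) (n : ℕ) :
    k = alt i j n ∨ k = alt i j (n + 1) := by
  by_cases hn : Even n <;> simp [alt, Nat.even_add_one, hn, h, h.symm]

theorem length_line (w : List (Fin 4)) (i j : Fin 4) (n : ℕ) :
    (line w i j n).length = w.length + n := by
  induction n with
  | zero => rfl
  | succ n ih => rw [line, List.length_cons, ih]; rfl

theorem line_injective (w : List (Fin 4)) (i j : Fin 4) : Function.Injective (line w i j) :=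
  fun m n h => by
    have := congrArg List.length h
    rw [length_line, length_line] at this
    omega

theorem reduced_cons_line {w : List (Fin 4)} {i j : Fin 4} (hij : i ≠ j) (h : Reduced (i :: w))
    (n : ℕ) : Reduced (alt i j n :: line w i j n) := by
  induction n with
  | zero => exact h
  | succ n ih => exact List.isChain_cons_cons.2 ⟨alt_succ_ne hij n, ih⟩

section Line

variable {M : Type*} {y : List (Fin 4) → Fin 4 → M} {w : List (Fin 4)} {i j : Fin 4}

theorem line_fixed (hy : ∀ {k w}, Reduced (k :: w) → ∀ {l}, l ≠ k → y (k :: w) l = y w l)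
    (hij : i ≠ j) (h : Reduced (i :: w)) {k : Fin 4} (hi : k ≠ i) (hj : k ≠ j) (n : ℕ) :
    y (line w i j n) k = y w k := by
  induction n with
  | zero => rfl
  | succ n ih => exact (hy (reduced_cons_line hij h n) (alt_ne hi hj n)).trans ih

theorem line_next (hy : ∀ {k w}, Reduced (k :: w) → ∀ {l}, l ≠ k → y (k :: w) l = y w l)
    (hij : i ≠ j) (h : Reduced (i :: w)) (n : ℕ) :
    y (line w i j n) (alt i j (n + 1)) = y (line w i j (n + 1)) (alt i j (n + 1)) :=
  (hy (reduced_cons_line hij h n) (alt_succ_ne hij n)).symm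

end Line

/-- Functions on the tree of reduced words, with `F` positive, such that outside a finite part `F`
satisfies the Fibonacci recursion, `h` satisfies the corresponding inequality and has positive
sums on new pairs, and such that `h` grows at least linearly along alternating words. -/
structure IsGrowthPair (N : ℕ) (h F : List (Fin 4) → Fin 4 → ℝ) : Prop where
  keep : ∀ {k w}, Reduced (k :: w) → ∀ {l}, l ≠ k → h (k :: w) l = h w l
  keep' : ∀ {k w}, Reduced (k :: w) → ∀ {l}, l ≠ k → F (k :: w) l = F w l
  pos : ∀ w i, 0 < F w i
  sum_eq : ∀ {k w}, Reduced (k :: w) → N ≤ w.length →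
    F (k :: w) k = ∑ i ∈ Finset.univ.erase k, F w i
  sum_le : ∀ {k w}, Reduced (k :: w) → N ≤ w.length →
    ∑ i ∈ Finset.univ.erase k, h w i ≤ h (k :: w) k
  pair_pos : ∀ {k w}, Reduced (k :: w) → N ≤ w.length → ∀ {i}, i ≠ k →
    0 < h (k :: w) k + h (k :: w) i
  line_growth : ∀ {w i j}, i ≠ j → Reduced (i :: w) → w.length = N →
    ∃ c > 0, ∃ C : ℝ, ∀ᶠ n : ℕ in atTop, c * n - C ≤ h (line w i j n) (alt i j n)

namespace IsGrowthPair

variable {N : ℕ} {h F : List (Fin 4) → Fin 4 → ℝ}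

/-- The pairwise lower bound, for the colours `p` and `q` at the word `w`. -/
def PairGood (h F : List (Fin 4) → Fin 4 → ℝ) (κ : ℝ) (w : List (Fin 4)) (p q : Fin 4) : Prop :=
  κ * (F w p + F w q) ≤ h w p + h w q

theorem PairGood.symm {κ w p q} (hg : PairGood h F κ w p q) : PairGood h F κ w q p := by
  unfold PairGood at *; linarith

theorem PairGood.mono (H : IsGrowthPair N h F) {κ κ' w p q} (hg : PairGood h F κ w p q)
    (hκ : κ' ≤ κ) : PairGood h F κ' w p q :=
  (mul_le_mul_of_nonneg_right hκ (add_pos (H.pos w p) (H.pos w q)).le).trans hg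

/-- If `a, b, c` are the colours of the face, the new pair `k, a` has Fibonacci sum `(a + b) + (a +
c)`, and half the sum of all three pairs gives the bound for `k` alone. -/
theorem pairGood_cons (H : IsGrowthPair N h F) {κ : ℝ} {k w} (hk : Reduced (k :: w))
    (hN : N ≤ w.length) (hg : ∀ p q, p ≠ q → p ≠ k → q ≠ k → PairGood h F κ w p q) :
    (∀ p q, p ≠ q → PairGood h F κ (k :: w) p q) ∧ κ * F (k :: w) k ≤ h (k :: w) k := by
  have key : ∀ a, a ≠ k →
      PairGood h F κ (k :: w) k a ∧ κ * F (k :: w) k ≤ h (k :: w) k := by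
    intro a ha
    obtain ⟨b, c, hbk, hba, hck, hca, hbc⟩ := Fin.exists_ne_ne ha.symm
    have hF := H.sum_eq hk hN
    have hh := H.sum_le hk hN
    rw [Fin.sum_erase_eq _ ha.symm hbk hba hck hca hbc] at hF hh
    have h1 := hg a b hba.symm ha hbk
    have h2 := hg a c hca.symm ha hck
    have h3 := hg b c hbc hbk hck
    unfold PairGood at *
    rw [H.keep hk ha, H.keep' hk ha, hF]
    constructor <;> linarith
  refine ⟨fun p q hpq => ?_, ?_⟩
  · by_cases hp : p = k
    · subst hp; exact (key q hpq.symm).1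
    by_cases hq : q = k
    · subst hq; exact (key p hpq).1.symm
    have := hg p q hpq hp hq
    unfold PairGood at *
    rwa [H.keep hk hp, H.keep hk hq, H.keep' hk hp, H.keep' hk hq]
  · obtain ⟨a, ha⟩ := exists_ne k
    exact (key a ha).2

/-- Two of the three summands never change on the line, so each new value exceeds the previous one
by a constant. -/
theorem exists_line_bound (H : IsGrowthPair N h F) {w i j} (hij : i ≠ j) (hw : Reduced (i :: w))
    (hN : w.length = N) : ∃ A B : ℝ, ∀ n : ℕ, F (line w i j n) (alt i j n) ≤ A * n + B := by
  obtain ⟨k, l, hki, hkj, hli, hlj, hkl⟩ := Fin.exists_ne_ne hij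
  set x : ℕ → ℝ := fun n => F (line w i j n) (alt i j n) with hx
  have hrec : ∀ n, x (n + 2) = x (n + 1) + (F w k + F w l) := by
    intro n
    have hr := reduced_cons_line hij hw n
    have hs := H.sum_eq hr (by rw [length_line]; omega)
    rw [Fin.sum_erase_eq _ (alt_succ_ne hij n).symm (alt_ne hki hkj n) (alt_ne hki hkj (n + 1))
      (alt_ne hli hlj n) (alt_ne hli hlj (n + 1)) hkl, line_fixed H.keep' hij hw hki hkj,
      line_fixed H.keep' hij hw hli hlj, line_next H.keep' hij hw] at hs
    calc x (n + 2) = F (line w i j (n + 1)) (alt i j (n + 2)) :=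
          (line_next H.keep' hij hw (n + 1)).symm
      _ = F (line w i j (n + 1)) (alt i j n) := by rw [alt_add_two]
      _ = x (n + 1) + (F w k + F w l) := hs
  have h0 : 0 < x 0 := H.pos _ _
  have h1 : 0 < x 1 := H.pos _ _
  have hA : 0 < F w k + F w l := add_pos (H.pos _ _) (H.pos _ _)
  refine ⟨F w k + F w l, x 0 + x 1, fun n => ?_⟩
  change x n ≤ _
  induction n with
  | zero => simp [h1.le]
  | succ n ih =>
    cases n with
    | zero => push_cast; linarith
    | succ n => rw [hrec]; push_cast at ih ⊢; linarith

/-- The pair of the two fixed colours has to be left out: its `h`-sum is constant and need not be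
positive. From `n = 2` on, both alternating values were created beyond depth `N`, so `pair_pos`
applies to every other pair. -/
theorem exists_line_good (H : IsGrowthPair N h F) {w i j} (hij : i ≠ j) (hw : Reduced (i :: w))
    (hN : w.length = N) : ∃ κ > 0,
      (∀ n ≥ 2, ∀ p q, p ≠ q → (p = i ∨ p = j) → PairGood h F κ (line w i j n) p q) ∧
      ∀ᶠ n in atTop, κ * F (line w i j n) (alt i j n) ≤ h (line w i j n) (alt i j n) := by
  obtain ⟨c, hc, C, hC⟩ := H.line_growth hij hw hN
  obtain ⟨A, B, hAB⟩ := H.exists_line_bound hij hw hN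
  set f : ℕ → ℝ := fun n => h (line w i j n) (alt i j n) with hf
  set g : ℕ → ℝ := fun n => F (line w i j n) (alt i j n) with hg
  have hgpos : ∀ n, 0 < g n := fun n => H.pos _ _
  have hfn : ∀ n, h (line w i j n) (alt i j (n + 1)) = f (n + 1) := line_next H.keep hij hw
  have hgn : ∀ n, F (line w i j n) (alt i j (n + 1)) = g (n + 1) := line_next H.keep' hij hw
  have hpos : ∀ n ≥ 1, ∀ q, q ≠ alt i j (n + 1) →
      0 < f (n + 1) + h (line w i j n) q := by
    intro n hn q hq
    obtain ⟨m, rfl⟩ := Nat.exists_eq_add_of_le' hn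
    rw [← hfn]
    rw [alt_add_two] at hq ⊢
    exact H.pair_pos (reduced_cons_line hij hw m) (by rw [length_line]; omega) hq
  obtain ⟨κ₁, hκ₁, h1⟩ := exists_pos_eventually_mul_le hc hC hAB
  obtain ⟨κ₂, hκ₂, h2⟩ : ∃ κ > 0, ∀ n ≥ 1, κ * (g n + g (n + 1)) ≤ f n + f (n + 1) := by
    refine exists_pos_mul_le (f := fun n => f n + f (n + 1)) (g := fun n => g n + g (n + 1))
      (fun n hn => ?_) (fun n => add_pos (hgpos _) (hgpos _))
      (exists_pos_eventually_mul_le (c := 2 * c) (C := 2 * C - c) (A := 2 * A) (B := 2 * B + A)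
        (by positivity) ?_ fun n => ?_)
    · have := hpos n hn _ (alt_succ_ne hij n).symm
      rwa [add_comm] at this
    · filter_upwards [hC, (tendsto_add_atTop_nat 1).eventually hC] with n h1 h2
      push_cast at h2; linarith
    · have h1 := hAB n
      have h2 := hAB (n + 1)
      push_cast at h2; linarith
  have h3 : ∀ k : Fin 4, ∃ κ > 0, k ≠ i → k ≠ j →
      ∀ n ≥ 2, κ * (g n + F w k) ≤ f n + h w k := by
    intro k
    by_cases hk : k ≠ i ∧ k ≠ j
    · suffices ∃ κ > 0, ∀ n ≥ 2, κ * (g n + F w k) ≤ f n + h w k by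
        obtain ⟨κ, hκ, h⟩ := this
        exact ⟨κ, hκ, fun _ _ => h⟩
      refine exists_pos_mul_le (f := fun n => f n + h w k)
        (g := fun n => g n + F w k) (fun n hn => ?_)
        (fun n => add_pos (hgpos _) (H.pos _ _))
        (exists_pos_eventually_mul_le (c := c) (C := C - h w k) (A := A) (B := B + F w k)
          hc ?_ fun n => ?_)
      · obtain ⟨m, rfl⟩ := Nat.exists_eq_add_of_le' hn
        have := hpos (m + 1) (by omega) k (alt_ne hk.1 hk.2 _)
        rwa [line_fixed H.keep hij hw hk.1 hk.2] at this
      · filter_upwards [hC] with n h1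
        linarith
      · linarith [hAB n]
    · exact ⟨1, one_pos, fun h1 h2 => absurd ⟨h1, h2⟩ hk⟩
  choose κ₃ hκ₃ h3 using h3
  obtain ⟨κ₄, hκ₄, h4⟩ := exists_pos_le_of_finite (Set.finite_univ (α := Fin 4)) (f := κ₃)
    fun k _ => hκ₃ k
  refine ⟨min κ₁ (min κ₂ κ₄), by positivity, fun n hn => ?_, ?_⟩
  · have hle2 : min κ₁ (min κ₂ κ₄) ≤ κ₂ := (min_le_right _ _).trans (min_le_left _ _)
    have hle4 : min κ₁ (min κ₂ κ₄) ≤ κ₄ := (min_le_right _ _).trans (min_le_right _ _)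
    have hline : PairGood h F κ₂ (line w i j n) (alt i j n) (alt i j (n + 1)) := by
      unfold PairGood
      rw [hfn, hgn]
      exact h2 n (by omega)
    intro p q hpq hp
    by_cases hq : q = i ∨ q = j
    · refine PairGood.mono H ?_ hle2
      rcases eq_alt_or hp n with rfl | rfl <;> rcases eq_alt_or hq n with rfl | rfl
      exacts [absurd rfl hpq, hline, hline.symm, absurd rfl hpq]
    · push Not at hq
      refine PairGood.mono H (κ := κ₃ q) ?_ (hle4.trans (h4 q trivial))
      unfold PairGood
      rw [line_fixed H.keep hij hw hq.1 hq.2, line_fixed H.keep' hij hw hq.1 hq.2]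
      rcases eq_alt_or hp n with rfl | rfl
      · exact h3 q hq.1 hq.2 n hn
      · rw [hfn, hgn]
        exact h3 q hq.1 hq.2 (n + 1) (by omega)
  · filter_upwards [h1] with n hn
    exact (mul_le_mul_of_nonneg_right (min_le_left _ _) (hgpos n).le).trans hn

/-- The lower bound in the Fibonacci growth. -/
theorem exists_lower_bound (H : IsGrowthPair N h F) : ∃ κ > 0,
    {u | Reduced u ∧ ∃ k w, u = k :: w ∧ ¬ κ * F u k ≤ h u k}.Finite := by
  let Good (κ : ℝ) (w : List (Fin 4)) (i j : Fin 4) : Prop :=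
    (∀ n ≥ 2, ∀ p q, p ≠ q → (p = i ∨ p = j) → PairGood h F κ (line w i j n) p q) ∧
      ∀ᶠ n in atTop, κ * F (line w i j n) (alt i j n) ≤ h (line w i j n) (alt i j n)
  have hex : ∀ (w : List (Fin 4)) (i j : Fin 4), ∃ κ > 0,
      i ≠ j → Reduced (i :: w) → w.length = N → Good κ w i j := by
    intro w i j
    by_cases hc : i ≠ j ∧ Reduced (i :: w) ∧ w.length = N
    · obtain ⟨κ, hκ, hg⟩ := H.exists_line_good hc.1 hc.2.1 hc.2.2
      exact ⟨κ, hκ, fun _ _ _ => hg⟩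
    · exact ⟨1, one_pos, fun h1 h2 h3 => absurd ⟨h1, h2, h3⟩ hc⟩
  choose κ₀ hκ₀ hgood using hex
  have hI : {p : List (Fin 4) × Fin 4 × Fin 4 | p.1.length = N}.Finite :=
    ((List.finite_length_eq (Fin 4) N).prod (Set.finite_univ (α := Fin 4 × Fin 4))).subset
      fun p hp => ⟨hp, trivial⟩
  obtain ⟨κ, hκ, hle⟩ := exists_pos_le_of_finite hI (f := fun p => κ₀ p.1 p.2.1 p.2.2)
    fun p _ => hκ₀ _ _ _
  have hgood' : ∀ w i j, i ≠ j → Reduced (i :: w) → w.length = N → Good κ w i j := by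
    intro w i j hij hw hN
    obtain ⟨h1, h2⟩ := hgood w i j hij hw hN
    have hκκ : κ ≤ κ₀ w i j := hle (w, i, j) hN
    refine ⟨fun n hn p q hpq hp => (h1 n hn p q hpq hp).mono H hκκ, ?_⟩
    filter_upwards [h2] with n hn
    exact (mul_le_mul_of_nonneg_right hκκ (H.pos _ _).le).trans hn
  -- Beyond depth `N + 2` a word either still alternates after its first `N` letters, or it has left
  -- its line, and from then on all pairs are good.
  have hdich : ∀ u, Reduced u → N + 2 ≤ u.length →
      (∃ w i j n, i ≠ j ∧ Reduced (i :: w) ∧ w.length = N ∧ u = line w i j (n + 2)) ∨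
      ∃ k u', u = k :: u' ∧ (∀ p q, p ≠ q → PairGood h F κ u p q) ∧ κ * F u k ≤ h u k := by
    intro u
    induction u with
    | nil => intro _ h; simp at h
    | cons k u ih =>
      intro hu hlen
      rw [List.length_cons] at hlen
      rcases (show u.length = N + 1 ∨ N + 2 ≤ u.length by omega) with hN | hN
      · left
        cases u with
        | nil => simp at hN
        | cons i w =>
          refine ⟨w, i, k, 0, (List.isChain_cons_cons.1 hu).1.symm, reduced_tail hu,
            by simpa using hN, ?_⟩
          simp [line, alt]
      · rcases ih (reduced_tail hu) hN with ⟨w, i, j, n, hij, hw, hwN, rfl⟩ | ⟨_, _, rfl, hg, -⟩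
        · by_cases hk : k = alt i j (n + 2)
          · exact Or.inl ⟨w, i, j, n + 1, hij, hw, hwN, by rw [hk]; rfl⟩
          · right
            have hk' : k ≠ alt i j (n + 1) := (List.isChain_cons_cons.1 hu).1
            have hkij : k ≠ i ∧ k ≠ j := by
              rw [← not_or]
              intro h'
              rcases eq_alt_or h' (n + 1) with h1 | h1
              exacts [hk' h1, hk h1]
            refine ⟨k, _, rfl, H.pairGood_cons hu (by omega) fun p q hpq hpk hqk => ?_⟩
            have hg := (hgood' w i j hij hw hwN).1 (n + 2) (by omega)
            by_cases hp : p = i ∨ p = j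
            · exact hg p q hpq hp
            by_cases hq : q = i ∨ q = j
            · exact (hg q p hpq.symm hq).symm
            exfalso
            -- Here `p`, `q` and `k` would be three distinct colours outside `{i, j}`, but there are
            -- only two.
            push Not at hp hq
            obtain ⟨hp1, hp2⟩ := hp
            obtain ⟨hq1, hq2⟩ := hq
            obtain ⟨hk1, hk2⟩ := hkij
            omega
        · exact Or.inr ⟨k, _, rfl, H.pairGood_cons hu (by omega)
            fun p q hpq _ _ => hg p q hpq⟩
  refine ⟨κ, hκ, ?_⟩
  have hbad : ∀ p : List (Fin 4) × Fin 4 × Fin 4,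
      {u | p.2.1 ≠ p.2.2 ∧ Reduced (p.2.1 :: p.1) ∧ p.1.length = N ∧ ∃ n,
        u = line p.1 p.2.1 p.2.2 (n + 1) ∧ ¬ κ * F (line p.1 p.2.1 p.2.2 (n + 1))
          (alt p.2.1 p.2.2 n) ≤ h (line p.1 p.2.1 p.2.2 (n + 1)) (alt p.2.1 p.2.2 n)}.Finite := by
    rintro ⟨w, i, j⟩
    by_cases hc : i ≠ j ∧ Reduced (i :: w) ∧ w.length = N
    · obtain ⟨m, hm⟩ := eventually_atTop.1 (hgood' w i j hc.1 hc.2.1 hc.2.2).2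
      refine ((Set.finite_Iio m).image (line w i j)).subset ?_
      rintro u ⟨hij', hw', -, n, rfl, hn⟩
      refine ⟨n + 1, ?_, rfl⟩
      by_contra h'
      -- The newest value at step `n + 1` is the one due for replacement at step `n + 2`, which is
      -- how the asymptotic bound is indexed.
      rw [← alt_add_two i j n] at hn
      apply hn
      rw [line_next H.keep hij' hw', line_next H.keep' hij' hw']
      exact hm (n + 2) (by simp at h'; omega)
    · convert Set.finite_empty
      ext u
      simp only [Set.mem_ofPred_eq, Set.mem_empty_iff_false, iff_false]
      exact fun h' => hc ⟨h'.1, h'.2.1, h'.2.2.1⟩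
  refine ((List.finite_length_le (Fin 4) (N + 2)).union (hI.biUnion fun p _ => hbad p)).subset ?_
  rintro _ ⟨hu, k, u, rfl, hku⟩
  rcases le_or_gt (k :: u).length (N + 2) with hN | hN
  · exact Or.inl hN
  right
  rw [List.length_cons] at hN
  rcases hdich _ hu (by rw [List.length_cons]; omega) with
    ⟨w, i, j, n, hij, hw, hwN, heq⟩ | ⟨_, _, h1, -, h2⟩
  · refine Set.mem_biUnion (x := (w, i, j)) hwN ⟨hij, hw, hwN, n + 1, heq, ?_⟩
    have hk : k = alt i j (n + 1) := (List.cons_eq_cons.1 heq).1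
    rw [← heq, ← hk]
    exact hku
  · obtain ⟨rfl, rfl⟩ := List.cons_eq_cons.1 h1
    exact absurd h2 hku

end IsGrowthPair

/-! ### Exponential growth along alternating words -/

/-- A root `l` of modulus `1` would have `l⁻¹` as its conjugate, so `m = 2 + 2 Re l` would lie in
`[0, 4]`. Otherwise `l` or `l⁻¹` lies outside the unit circle. -/
theorem exists_one_lt_norm_add_inv {m : ℂ} (hm : ∀ r ∈ Set.Icc (0 : ℝ) 4, m ≠ r) :
    ∃ l : ℂ, 1 < ‖l‖ ∧ l + l⁻¹ = m - 2 := by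
  obtain ⟨s, hs⟩ := IsAlgClosed.exists_pow_nat_eq ((m - 2) ^ 2 - 4) two_pos
  set l := (m - 2 + s) / 2 with hl
  have h1 : l * (m - 2 - l) = 1 := by rw [hl]; linear_combination -hs / 4
  have h0 : l ≠ 0 := left_ne_zero_of_mul_eq_one h1
  have h2 : l + l⁻¹ = m - 2 := by rw [← eq_inv_of_mul_eq_one_right h1]; ring
  rcases lt_trichotomy ‖l‖ 1 with h | h | h
  · refine ⟨l⁻¹, ?_, by rw [inv_inv, add_comm, h2]⟩
    rw [norm_inv]
    exact (one_lt_inv₀ (norm_pos_iff.2 h0)).2 h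
  · exfalso
    have h3 : l⁻¹ = (starRingEnd ℂ) l := Complex.inv_eq_conj h
    have h4 : m = ((2 * l.re + 2 : ℝ) : ℂ) := by
      rw [h3, Complex.add_conj] at h2
      push_cast at h2 ⊢
      linear_combination -h2
    have h5 := abs_le.1 ((Complex.abs_re_le_norm l).trans h.le)
    exact hm _ ⟨by linarith, by linarith⟩ h4
  · exact ⟨l, h, h2⟩

/-- A solution of an inhomogeneous linear recursion of order two which is finite-to-one on bounded
sets grows exponentially if the characteristic roots are off the unit circle. -/
theorem exists_linear_le_log_norm {x : ℕ → ℂ} {m t : ℂ} (hm : ∀ r ∈ Set.Icc (0 : ℝ) 4, m ≠ r)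
    (hx : ∀ n, x (n + 2) = (m - 2) * x (n + 1) - x n - t)
    (hfin : ∀ K : ℝ, {n | ‖x n‖ ≤ K}.Finite) :
    ∃ c > 0, ∃ C : ℝ, ∀ᶠ n : ℕ in atTop, c * n - C ≤ Real.log ‖x n‖ := by
  obtain ⟨l, hl, hlm⟩ := exists_one_lt_norm_add_inv hm
  have hl0 : l ≠ 0 := norm_pos_iff.1 (one_pos.trans hl)
  have hl1 : l - 1 ≠ 0 := by
    intro h
    rw [sub_eq_zero.1 h] at hl
    simp at hl
  have hli : l * l⁻¹ = 1 := mul_inv_cancel₀ hl0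
  have hρ1 : ‖l⁻¹‖ < 1 := by rw [norm_inv]; exact inv_lt_one_of_one_lt₀ hl
  set D := l - l⁻¹ with hD
  have hD0 : D ≠ 0 := by
    intro h
    have : ‖l‖ = ‖l⁻¹‖ := by rw [← sub_eq_zero.1 h]
    linarith
  -- The fixed point of `y ↦ l y - t`; subtracting it makes `x (n + 1) - l⁻¹ x n` purely geometric
  -- with ratio `l`.
  set f := t / (l - 1) with hf
  have hft : l * f - t = f := by rw [hf]; field_simp; ring
  have hy : ∀ n, x (n + 1) - l⁻¹ * x n - f = l ^ n * (x 1 - l⁻¹ * x 0 - f) := by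
    intro n
    induction n with
    | zero => simp
    | succ n ih =>
      rw [pow_succ', mul_assoc, ← ih, hx, ← hlm]
      linear_combination hft + x n * hli
  -- The companion combination `x (n + 1) - l x n` obeys a contraction with ratio `l⁻¹`, so it stays
  -- bounded. The difference of the two combinations is `D x n`.
  set Z := ‖x 1 - l * x 0‖ + ‖t‖ / (1 - ‖l⁻¹‖) with hZ
  have hz : ∀ n, ‖x (n + 1) - l * x n‖ ≤ Z := by
    intro n
    have hρ : 0 < 1 - ‖l⁻¹‖ := by linarith
    induction n with
    | zero => exact le_add_of_nonneg_right (by positivity)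
    | succ n ih =>
      have : x (n + 1 + 1) - l * x (n + 1) = l⁻¹ * (x (n + 1) - l * x n) - t := by
        rw [hx, ← hlm]; linear_combination x n * hli
      rw [this]
      refine (norm_sub_le _ _).trans ?_
      rw [norm_mul]
      have h1 : ‖l⁻¹‖ * ‖x (n + 1) - l * x n‖ ≤ ‖l⁻¹‖ * Z := by gcongr
      have h2 : ‖t‖ ≤ (1 - ‖l⁻¹‖) * Z := by
        have e : (1 - ‖l⁻¹‖) * (‖t‖ / (1 - ‖l⁻¹‖)) = ‖t‖ := by
          rw [mul_div_assoc']; exact mul_div_cancel_left₀ _ hρ.ne'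
        rw [hZ, mul_add, e]
        exact le_add_of_nonneg_left (by positivity)
      linarith
  set y₀ := x 1 - l⁻¹ * x 0 - f with hy₀
  have hDx : ∀ n, D * x n = l ^ n * y₀ + f - (x (n + 1) - l * x n) := by
    intro n
    rw [← hy n, hD]; ring
  have hDn : 0 < ‖D‖ := norm_pos_iff.2 hD0
  -- Without the growing component the sequence would be bounded, against `hfin`.
  have hy₀0 : y₀ ≠ 0 := by
    intro h0
    refine Set.infinite_univ ((hfin ((‖f‖ + Z) / ‖D‖)).subset fun n _ => ?_)
    rw [Set.mem_ofPred_eq, le_div_iff₀ hDn, mul_comm, ← norm_mul, hDx, h0, mul_zero, zero_add]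
    exact (norm_sub_le _ _).trans (by gcongr; exact hz n)
  have hyn : 0 < ‖y₀‖ := norm_pos_iff.2 hy₀0
  refine ⟨Real.log ‖l‖, Real.log_pos hl, - Real.log (‖y₀‖ / (2 * ‖D‖)), ?_⟩
  have hlarge : ∀ᶠ n : ℕ in atTop, 2 * (‖f‖ + Z) / ‖y₀‖ ≤ ‖l‖ ^ n :=
    (tendsto_pow_atTop_atTop_of_one_lt hl).eventually_ge_atTop _
  filter_upwards [hlarge] with n hn
  rw [div_le_iff₀ hyn] at hn
  have h1 : ‖l‖ ^ n * ‖y₀‖ ≤ ‖D‖ * ‖x n‖ + (‖f‖ + Z) := by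
    have e : l ^ n * y₀ = D * x n + ((x (n + 1) - l * x n) - f) := by rw [hDx]; ring
    rw [← norm_pow, ← norm_mul, ← norm_mul, e]
    refine (norm_add_le _ _).trans ?_
    gcongr
    refine (norm_sub_le _ _).trans ?_
    linarith [hz n]
  have h2 : ‖l‖ ^ n * (‖y₀‖ / (2 * ‖D‖)) ≤ ‖x n‖ := by
    rw [← mul_div_assoc, div_le_iff₀ (by positivity)]
    linarith
  have h3 : 0 < ‖l‖ ^ n := by positivity
  have h4 : 0 < ‖y₀‖ / (2 * ‖D‖) := by positivity
  have h5 := Real.log_le_log (by positivity) h2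
  rw [Real.log_mul h3.ne' h4.ne', Real.log_pow] at h5
  linarith

/-! ### Lower and upper bounds for BQ maps -/

/-- `F` is positive and satisfies the Fibonacci recursion outside a finite part of the tree. -/
structure IsFibonacciWordMap (F : List (Fin 4) → Fin 4 → ℝ) : Prop where
  keep : ∀ {k w}, Reduced (k :: w) → ∀ {l}, l ≠ k → F (k :: w) l = F w l
  pos : ∀ w i, 0 < F w i
  finite : {u | Reduced u ∧ ∃ k w, u = k :: w ∧
    F u k ≠ ∑ i ∈ Finset.univ.erase k, F w i}.Finite

namespace IsBQWordMap

variable {v : List (Fin 4) → Fin 4 → ℂ}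

/-- With `a, b` fixed, the edge relation reads `d = (ab - 2)c - d' - 2(a + b)`. -/
theorem exists_line_growth (hv : IsBQWordMap v) {w i j} (hij : i ≠ j) (hw : Reduced (i :: w)) :
    ∃ c > 0, ∃ C : ℝ, ∀ᶠ n : ℕ in atTop,
      c * n - C ≤ Real.log ‖v (line w i j n) (alt i j n)‖ := by
  obtain ⟨k, l, hki, hkj, hli, hlj, hkl⟩ := Fin.exists_ne_ne hij
  have hnext : ∀ n, v (line w i j n) (alt i j (n + 1)) =
      v (line w i j (n + 1)) (alt i j (n + 1)) := line_next hv.keep hij hw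
  have hnew : ∀ n, v (line w i j (n + 1)) (alt i j n) =
      v (line w i j (n + 2)) (alt i j (n + 2)) := fun n => by
    rw [← hnext (n + 1), alt_add_two]
  refine exists_linear_le_log_norm (m := v w k * v w l) (t := 2 * (v w k + v w l))
    (hv.mul_ne (reduced_tail hw) hkl) (fun n => ?_) fun K => ?_
  · have h := hv.edge (reduced_cons_line hij hw n)
    rw [Fin.sum_erase_eq _ (alt_succ_ne hij n).symm (alt_ne hki hkj n) (alt_ne hki hkj (n + 1))
      (alt_ne hli hlj n) (alt_ne hli hlj (n + 1)) hkl,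
      Fin.prod_erase_eq _ (alt_succ_ne hij n).symm (alt_ne hki hkj n) (alt_ne hki hkj (n + 1))
      (alt_ne hli hlj n) (alt_ne hli hlj (n + 1)) hkl, line_fixed hv.keep hij hw hki hkj,
      line_fixed hv.keep hij hw hli hlj, hnext] at h
    have h' := hnew n
    rw [line] at h'
    rw [h'] at h
    linear_combination h
  -- A small value on the line makes a small product with the fixed nonzero value of colour `k`. The
  -- values with `n < 2` may be older than the line and are set aside.
  · have hf := (hv.finite (K * ‖v w k‖)).preimage
      ((line_injective w i j).comp (add_left_injective 1)).injOn
    refine ((hf.image (· + 2)).union (Set.finite_Iio 2)).subset fun n hn => ?_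
    rcases lt_or_ge n 2 with h2 | h2
    · exact Or.inr h2
    obtain ⟨n, rfl⟩ := Nat.exists_eq_add_of_le' h2
    refine Or.inl ⟨n, ⟨reduced_cons_line hij hw n, alt i j n, line w i j n, rfl, k,
      alt_ne hki hkj n, ?_⟩, rfl⟩
    change ‖v (line w i j (n + 1)) (alt i j n) * v (line w i j (n + 1)) k‖ ≤ _
    rw [hnew, line_fixed hv.keep hij hw hki hkj, norm_mul]
    exact mul_le_mul_of_nonneg_right hn (norm_nonneg _)

theorem exists_length_bound {S : Set (List (Fin 4))} (hS : S.Finite) :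
    ∃ N, ∀ u ∈ S, u.length ≤ N := by
  obtain ⟨N, hN⟩ := (hS.image List.length).bddAbove
  exact ⟨N, fun u hu => hN ⟨u, hu, rfl⟩⟩

/-- The shift by `log 2` does two jobs: three copies against one absorb the factor `4` of
`norm_prod_le`, and `h p + h q > 0` means that the product exceeds `4`, true for all but finitely
many pairs. -/
theorem exists_isGrowthPair (hv : IsBQWordMap v) {F : List (Fin 4) → Fin 4 → ℝ}
    (hF : IsFibonacciWordMap F) :
    ∃ N, IsGrowthPair N (fun w i => Real.log ‖v w i‖ - Real.log 2) F := by
  obtain ⟨N, hN⟩ := exists_length_bound ((hv.finite_decreasing.union (hv.finite 4)).union hF.finite)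
  have hN' : ∀ {k : Fin 4} {w : List (Fin 4)}, N ≤ w.length → ¬ (k :: w).length ≤ N := by
    intro k w h; rw [List.length_cons]; omega
  have hlog4 : Real.log 4 = 2 * Real.log 2 := by
    rw [show (4 : ℝ) = 2 ^ 2 by norm_num, Real.log_pow]; norm_num
  refine ⟨N, ⟨fun hk l hl => ?_, hF.keep, hF.pos, fun {k w} hk hN₁ => ?_, fun {k w} hk hN₁ => ?_,
    fun {k w} hk hN₁ i hi => ?_, fun hij hw _ => ?_⟩⟩
  · simp only [hv.keep hk hl]
  · by_contra h
    exact hN' hN₁ (hN _ (Or.inr ⟨hk, k, w, rfl, h⟩))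
  · have hle : ‖v w k‖ ≤ ‖v (k :: w) k‖ := by
      by_contra! h
      exact hN' hN₁ (hN _ (Or.inl (Or.inl ⟨hk, k, w, rfl, h⟩)))
    have h1 := hv.norm_prod_le hk hle
    have hne : ∀ i ∈ Finset.univ.erase k, ‖v w i‖ ≠ 0 := fun i _ =>
      norm_ne_zero_iff.2 (hv.ne_zero (reduced_tail hk) i)
    rw [norm_prod] at h1
    have h2 := Real.log_le_log (Finset.prod_pos fun i hi =>
      lt_of_le_of_ne (norm_nonneg _) (hne i hi).symm) h1
    rw [Real.log_prod hne, Real.log_mul (by norm_num) (norm_ne_zero_iff.2 (hv.ne_zero hk k)),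
      hlog4] at h2
    have hc : (Finset.univ.erase k).card = 3 := by simp
    rw [Finset.sum_sub_distrib, Finset.sum_const, hc, nsmul_eq_mul]
    push_cast
    linarith
  · have hlt : 4 < ‖v (k :: w) k * v (k :: w) i‖ := by
      by_contra! h
      exact hN' hN₁ (hN _ (Or.inl (Or.inr ⟨hk, k, w, rfl, i, hi, h⟩)))
    have h1 := Real.log_lt_log (by norm_num) hlt
    rw [norm_mul, Real.log_mul (norm_ne_zero_iff.2 (hv.ne_zero hk k))
      (norm_ne_zero_iff.2 (hv.ne_zero hk i)), hlog4] at h1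
    linarith
  · obtain ⟨c, hc, C, hC⟩ := hv.exists_line_growth hij hw
    refine ⟨c, hc, C + Real.log 2, ?_⟩
    filter_upwards [hC] with n hn
    linarith

/-- With all moduli replaced by their maximum with `1`, `norm_le` gives at most `(1 + 3·3)` times
the product of the other three; hence the `10`. -/
theorem posLog_le_sum (hv : IsBQWordMap v) {w} (hw : Reduced w) (k : Fin 4) :
    Real.posLog ‖v w k‖ + Real.log 10 ≤
      ∑ i ∈ Finset.univ.erase k, (Real.posLog ‖v w i‖ + Real.log 10) := by
  obtain ⟨j, hj⟩ := exists_ne k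
  obtain ⟨a, b, hak, haj, hbk, hbj, hab⟩ := Fin.exists_ne_ne hj.symm
  have h := hv.norm_le hw k
  rw [Fin.prod_erase_eq _ hj.symm hak haj hbk hbj hab,
    Fin.sum_erase_eq _ hj.symm hak haj hbk hbj hab] at h
  rw [Fin.sum_erase_eq _ hj.symm hak haj hbk hbj hab]
  have hpl : ∀ z : ℂ, Real.posLog ‖z‖ = Real.log (max 1 ‖z‖) := fun z =>
    Real.posLog_eq_log_max_one (norm_nonneg z)
  set A := max 1 ‖v w j‖ with hA
  set B := max 1 ‖v w a‖ with hB
  set C := max 1 ‖v w b‖ with hC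
  have hA1 : 1 ≤ A := le_max_left _ _
  have hB1 : 1 ≤ B := le_max_left _ _
  have hC1 : 1 ≤ C := le_max_left _ _
  have hAB : 1 ≤ A * B := one_le_mul_of_one_le_of_one_le hA1 hB1
  have hBC : 1 ≤ B * C := one_le_mul_of_one_le_of_one_le hB1 hC1
  have hAC : 1 ≤ A * C := one_le_mul_of_one_le_of_one_le hA1 hC1
  have hAA : ‖v w j‖ ≤ A := le_max_right _ _
  have hBB : ‖v w a‖ ≤ B := le_max_right _ _
  have hCC : ‖v w b‖ ≤ C := le_max_right _ _
  have h1 : ‖v w j * (v w a * v w b)‖ ≤ A * (B * C) := by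
    rw [norm_mul, norm_mul]; gcongr
  have h2 : ‖v w j + (v w a + v w b)‖ ≤ A + (B + C) :=
    (norm_add_le _ _).trans (add_le_add hAA ((norm_add_le _ _).trans (add_le_add hBB hCC)))
  have h3 : max 1 ‖v w k‖ ≤ 10 * (A * (B * C)) := by
    have e1 : A ≤ A * (B * C) := le_mul_of_one_le_right (by linarith) hBC
    have e2 : B ≤ A * (B * C) := by nlinarith
    have e3 : C ≤ A * (B * C) := by nlinarith
    exact max_le (by linarith) (by linarith)
  have h4 := Real.log_le_log (by positivity) h3
  rw [Real.log_mul (by norm_num) (by positivity), Real.log_mul (by positivity) (by positivity),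
    Real.log_mul (by positivity) (by positivity)] at h4
  rw [hpl, hpl, hpl, hpl]
  have : 0 < Real.log 10 := Real.log_pos (by norm_num)
  linarith

/-- The upper bound in the Fibonacci growth. -/
theorem exists_upper_bound (hv : IsBQWordMap v) {F : List (Fin 4) → Fin 4 → ℝ}
    (hF : IsFibonacciWordMap F) :
    ∃ κ > 0, ∀ w, Reduced w → ∀ i, Real.posLog ‖v w i‖ ≤ κ * F w i := by
  obtain ⟨N, hN⟩ := exists_length_bound hF.finite
  set g : List (Fin 4) → Fin 4 → ℝ := fun w i => Real.posLog ‖v w i‖ + Real.log 10 with hg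
  have hlog : 0 < Real.log 10 := Real.log_pos (by norm_num)
  have hgpos : ∀ w i, 0 < g w i := fun w i => add_pos_of_nonneg_of_pos Real.posLog_nonneg hlog
  obtain ⟨ε, hε, hle⟩ := exists_pos_le_of_finite
    ((List.finite_length_le (Fin 4) N).prod (Set.finite_univ (α := Fin 4)))
    (f := fun p => F p.1 p.2 / g p.1 p.2) fun p _ => div_pos (hF.pos _ _) (hgpos _ _)
  suffices h : ∀ w, Reduced w → ∀ i, ε * g w i ≤ F w i by
    refine ⟨1 / ε, by positivity, fun w hw i => ?_⟩
    rw [one_div, inv_mul_eq_div, le_div_iff₀ hε]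
    have : ε * Real.posLog ‖v w i‖ ≤ ε * g w i := by
      gcongr; exact le_add_of_nonneg_right hlog.le
    linarith [h w hw i]
  have hshort : ∀ w, w.length ≤ N → ∀ i, ε * g w i ≤ F w i := fun w hw i => by
    have := hle (w, i) ⟨hw, trivial⟩
    rwa [le_div_iff₀ (hgpos _ _)] at this
  intro w
  induction w with
  | nil => exact fun _ => hshort [] (by simp)
  | cons k w ih =>
    intro hw i
    have ih := ih (reduced_tail hw)
    rcases le_or_gt (k :: w).length N with hlen | hlen
    · exact hshort _ hlen i
    by_cases hik : i = k
    · subst hik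
      have hrec : F (i :: w) i = ∑ l ∈ Finset.univ.erase i, F w l := by
        by_contra h
        exact hlen.not_ge (hN _ ⟨hw, i, w, rfl, h⟩)
      have hsum : ∑ l ∈ Finset.univ.erase i, g (i :: w) l = ∑ l ∈ Finset.univ.erase i, g w l :=
        Finset.sum_congr rfl fun l hl => by
          simp only [hg, hv.keep hw (Finset.ne_of_mem_erase hl)]
      calc ε * g (i :: w) i ≤ ε * ∑ l ∈ Finset.univ.erase i, g w l := by
            rw [← hsum]; gcongr; exact hv.posLog_le_sum hw i
        _ = ∑ l ∈ Finset.univ.erase i, ε * g w l := Finset.mul_sum _ _ _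
        _ ≤ ∑ l ∈ Finset.univ.erase i, F w l := Finset.sum_le_sum fun l _ => ih l
        _ = F (i :: w) i := hrec.symm
    · simp only [hg, hv.keep hw hik, hF.keep hw hik]
      exact ih i

/-- Fibonacci growth on the tree of reduced words. -/
theorem exists_growth (hv : IsBQWordMap v) {F : List (Fin 4) → Fin 4 → ℝ}
    (hF : IsFibonacciWordMap F) :
    ∃ κ > 0, {u | Reduced u ∧ ∃ k w, u = k :: w ∧
      ¬ (1 / κ * F u k ≤ Real.posLog ‖v u k‖ ∧ Real.posLog ‖v u k‖ ≤ κ * F u k)}.Finite := by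
  obtain ⟨N, H⟩ := hv.exists_isGrowthPair hF
  obtain ⟨κ₁, hκ₁, h1⟩ := H.exists_lower_bound
  obtain ⟨κ₂, hκ₂, h2⟩ := hv.exists_upper_bound hF
  refine ⟨max (1 / κ₁) κ₂, lt_max_of_lt_right hκ₂, h1.subset ?_⟩
  rintro _ ⟨hu, k, w, rfl, hk⟩
  refine ⟨hu, k, w, rfl, fun h3 => hk ⟨?_, ?_⟩⟩
  · have h4 : 1 / max (1 / κ₁) κ₂ ≤ κ₁ := by
      rw [one_div_le (lt_max_of_lt_right hκ₂) hκ₁]; exact le_max_left _ _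
    have h5 : Real.log ‖v (k :: w) k‖ ≤ Real.posLog ‖v (k :: w) k‖ := le_max_right _ _
    have h6 : 0 < Real.log 2 := Real.log_pos (by norm_num)
    have := mul_le_mul_of_nonneg_right h4 (hF.pos (k :: w) k).le
    linarith
  · exact (h2 _ hu k).trans (mul_le_mul_of_nonneg_right (le_max_right _ _) (hF.pos _ _).le)

end IsBQWordMap

/-! ### The Fibonacci function: existence and uniqueness -/

/-- The value of the colour `j` is replaced by the sum of the other three. -/
def sumFlip (j : Fin 4) (f : Fin 4 → ℝ) : Fin 4 → ℝ :=
  Function.update f j (∑ i ∈ Finset.univ.erase j, f i)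

theorem sumFlip_pos {f : Fin 4 → ℝ} (hf : ∀ i, 0 < f i) (j i : Fin 4) : 0 < sumFlip j f i := by
  by_cases h : i = j
  · subst h
    obtain ⟨k, hk⟩ := exists_ne i
    simpa [sumFlip] using Finset.sum_pos (fun l _ => hf l)
      ⟨k, Finset.mem_erase.2 ⟨hk, Finset.mem_univ k⟩⟩
  · simpa [sumFlip, h] using hf i

theorem sum_erase_sumFlip (j : Fin 4) (f : Fin 4 → ℝ) :
    ∑ i ∈ Finset.univ.erase j, sumFlip j f i = ∑ i ∈ Finset.univ.erase j, f i :=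
  Finset.sum_congr rfl fun i hi => by simp [sumFlip, Finset.ne_of_mem_erase hi]

/-- The Fibonacci function of the face opposite to the colour `j` of the tetrahedron `u`, on the
tetrahedra between `u` and the initial one, which are given by the suffixes of `u`. -/
def pathFib (j : Fin 4) (u w : List (Fin 4)) : Fin 4 → ℝ :=
  (u.take (u.length - w.length)).foldl (fun f k => sumFlip k f) (sumFlip j fun _ => 1)

theorem pathFib_self (j : Fin 4) (u : List (Fin 4)) :
    pathFib j u u = sumFlip j fun _ => 1 := by
  simp [pathFib]

theorem pathFib_of_cons_suffix {j k : Fin 4} {u w : List (Fin 4)} (h : k :: w <:+ u) :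
    pathFib j u w = sumFlip k (pathFib j u (k :: w)) := by
  obtain ⟨l, rfl⟩ := h
  have h1 : (l ++ k :: w).take ((l ++ k :: w).length - w.length) = l ++ [k] := by
    rw [show l ++ k :: w = (l ++ [k]) ++ w by simp]
    exact List.take_left' (by simp; omega)
  have h2 : (l ++ k :: w).take ((l ++ k :: w).length - (k :: w).length) = l :=
    List.take_left' (by simp)
  rw [pathFib, pathFib, h1, h2, List.foldl_append]
  rfl

theorem pathFib_pos (j : Fin 4) (u w : List (Fin 4)) (i : Fin 4) : 0 < pathFib j u w i := by
  have key : ∀ (l : List (Fin 4)) (f : Fin 4 → ℝ), (∀ i, 0 < f i) →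
      ∀ i, 0 < l.foldl (fun f k => sumFlip k f) f i := by
    intro l
    induction l with
    | nil => exact fun f hf => hf
    | cons k l ih => exact fun f hf => ih _ (sumFlip_pos hf k)
  exact key _ _ (sumFlip_pos (fun _ => one_pos) j) i

open Classical in
/-- The Fibonacci function of the face opposite to the colour `j` of the tetrahedron `u`, on the
vertices of all tetrahedra. -/
noncomputable def wordFib (j : Fin 4) (u : List (Fin 4)) : List (Fin 4) → Fin 4 → ℝ
  | [] => pathFib j u []
  | k :: w => if k :: w <:+ u then pathFib j u (k :: w) else sumFlip k (wordFib j u w)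

theorem wordFib_of_suffix {j : Fin 4} {u w : List (Fin 4)} (h : w <:+ u) :
    wordFib j u w = pathFib j u w := by
  cases w with
  | nil => rfl
  | cons k w => rw [wordFib, if_pos h]

theorem wordFib_of_not_suffix {j k : Fin 4} {u w : List (Fin 4)} (h : ¬ k :: w <:+ u) :
    wordFib j u (k :: w) = sumFlip k (wordFib j u w) := by
  rw [wordFib, if_neg h]

theorem wordFib_cons_of_ne {j k i : Fin 4} {u w : List (Fin 4)} (h : i ≠ k) :
    wordFib j u (k :: w) i = wordFib j u w i := by
  by_cases hs : k :: w <:+ u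
  · rw [wordFib_of_suffix hs, wordFib_of_suffix ((List.suffix_cons k w).trans hs),
      pathFib_of_cons_suffix hs]
    simp [sumFlip, h]
  · rw [wordFib_of_not_suffix hs]
    simp [sumFlip, h]

theorem wordFib_pos (j : Fin 4) (u w : List (Fin 4)) (i : Fin 4) : 0 < wordFib j u w i := by
  induction w generalizing i with
  | nil => exact pathFib_pos j u [] i
  | cons k w ih =>
    by_cases hs : k :: w <:+ u
    · rw [wordFib_of_suffix hs]; exact pathFib_pos j u _ i
    · rw [wordFib_of_not_suffix hs]; exact sumFlip_pos ih k i

theorem wordFib_cons_self {j k : Fin 4} {u w : List (Fin 4)} (h : ¬ k :: w <:+ u) :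
    wordFib j u (k :: w) k = ∑ i ∈ Finset.univ.erase k, wordFib j u w i := by
  rw [wordFib_of_not_suffix h]; simp [sumFlip]

theorem wordFib_of_cons_suffix {j k : Fin 4} {u w : List (Fin 4)} (h : k :: w <:+ u) :
    wordFib j u w k = ∑ i ∈ Finset.univ.erase k, wordFib j u w i := by
  rw [wordFib_of_suffix ((List.suffix_cons k w).trans h), pathFib_of_cons_suffix h,
    sum_erase_sumFlip]
  simp [sumFlip]

theorem wordFib_self (j : Fin 4) (u : List (Fin 4)) :
    wordFib j u u j = ∑ i ∈ Finset.univ.erase j, wordFib j u u i := by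
  rw [wordFib_of_suffix List.suffix_rfl, pathFib_self, sum_erase_sumFlip]
  simp [sumFlip]

theorem wordFib_self_of_ne {i j : Fin 4} (u : List (Fin 4)) (h : i ≠ j) :
    wordFib j u u i = 1 := by
  rw [wordFib_of_suffix List.suffix_rfl, pathFib_self]
  simp [sumFlip, h]

theorem isFibonacciWordMap_wordFib (j : Fin 4) (u : List (Fin 4)) :
    IsFibonacciWordMap (wordFib j u) where
  keep _ _ h := wordFib_cons_of_ne h
  pos := wordFib_pos j u
  finite := by
    refine (List.finite_length_le (Fin 4) u.length).subset ?_
    rintro _ ⟨-, k, w, rfl, h⟩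
    by_contra h'
    exact h (wordFib_cons_self fun hs => h' hs.length_le)

/-- The Fibonacci function of the face opposite to the colour `j` of the tetrahedron `u`. -/
noncomputable def fib (j : Fin 4) (u : List (Fin 4)) (X : Cell) : ℝ :=
  wordFib j u X.birth X.color

theorem fib_cell (j : Fin 4) (u : List (Fin 4)) {w : List (Fin 4)} (hw : Reduced w) (i : Fin 4) :
    fib j u (cell w i) = wordFib j u w i := by
  induction w with
  | nil => rw [cell_nil]; rfl
  | cons k w ih =>
    by_cases hik : i = k
    · subst hik; rw [cell_cons_self hw]; rfl
    · rw [cell_cons_of_ne hw hik, ih (reduced_tail hw), wordFib_cons_of_ne hik]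

theorem sum_face {M : Type*} [AddCommMonoid M] (f : Cell → M) (j : Fin 4) (w : List (Fin 4)) :
    ∑ X ∈ face j w, f X = ∑ i ∈ Finset.univ.erase j, f (cell w i) :=
  Finset.sum_image (cell_injective w).injOn

theorem prod_face {M : Type*} [CommMonoid M] (f : Cell → M) (j : Fin 4) (w : List (Fin 4)) :
    ∏ X ∈ face j w, f X = ∏ i ∈ Finset.univ.erase j, f (cell w i) :=
  Finset.prod_image (cell_injective w).injOn

theorem pointsAwayFrom_iff {j : Fin 4} {u : List (Fin 4)} (hu : Reduced (j :: u))
    {t : Finset Cell} {δ' δ : Cell} : PointsAwayFrom (face j u) t δ' δ ↔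
      skeleton.dist (tet u) (insert δ' t) < skeleton.dist (tet u) (insert δ t) ∨
      skeleton.dist (tet (j :: u)) (insert δ' t) < skeleton.dist (tet (j :: u)) (insert δ t) := by
  constructor
  · rintro ⟨s, hs, hes, h⟩
    obtain ⟨v, hv, rfl⟩ := exists_tet_of_mem_Omega0 hs
    rcases eq_or_eq_of_face_subset_tet hu hv hes with rfl | rfl
    exacts [Or.inl h, Or.inr h]
  · rintro (h | h)
    · exact ⟨_, tet_mem_Omega0 (reduced_tail hu), face_subset_tet_self j u, h⟩
    · exact ⟨_, tet_mem_Omega0 hu, face_cons hu ▸ face_subset_tet_self j (j :: u), h⟩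

/-- An edge leading away from the root points away from `e` unless it lies on the path from the root
to `u`. -/
theorem pointsAwayFrom_down_iff {j k : Fin 4} {u w : List (Fin 4)} (hu : Reduced (j :: u))
    (hw : Reduced (k :: w)) :
    PointsAwayFrom (face j u) (face k w) (cell w k) (cell (k :: w) k) ↔ ¬ k :: w <:+ u := by
  rw [pointsAwayFrom_iff hu, insert_cell_face, insert_cell_cons_face hw]
  constructor
  · rintro (h | h) hs
    · exact (dist_lt_of_suffix (reduced_tail hu) hs).not_gt h
    · exact (dist_lt_of_suffix hu (hs.trans (List.suffix_cons j u))).not_gt h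
  · exact fun hs => Or.inl (dist_lt_of_not_suffix (reduced_tail hu) hw hs)

/-- Here `j :: u` replaces `u` in the suffix condition, so that `e` itself counts in both
directions. -/
theorem pointsAwayFrom_up_iff {j k : Fin 4} {u w : List (Fin 4)} (hu : Reduced (j :: u))
    (hw : Reduced (k :: w)) :
    PointsAwayFrom (face j u) (face k w) (cell (k :: w) k) (cell w k) ↔ k :: w <:+ j :: u := by
  rw [pointsAwayFrom_iff hu, insert_cell_face, insert_cell_cons_face hw]
  constructor
  · intro h
    by_contra hs
    rcases h with h | h
    · exact (dist_lt_of_not_suffix (reduced_tail hu) hw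
        fun h' => hs (h'.trans (List.suffix_cons j u))).not_gt h
    · exact (dist_lt_of_not_suffix hu hw hs).not_gt h
  · exact fun hs => Or.inr (dist_lt_of_suffix hu hs)

theorem isFibonacciFunction_fib {j : Fin 4} {u : List (Fin 4)} (hu : Reduced (j :: u)) :
    IsFibonacciFunction (face j u) (fib j u) where
  eq_one X hX := by
    obtain ⟨i, hi, rfl⟩ := mem_face.1 hX
    rw [fib_cell j u (reduced_tail hu), wordFib_self_of_ne u hi]
  eq_sum t δ' δ h haway := by
    obtain ⟨k, w, hw, rfl, ⟨rfl, rfl⟩ | ⟨rfl, rfl⟩⟩ := h.exists_word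
    · rw [pointsAwayFrom_down_iff hu hw] at haway
      rw [fib_cell j u hw, wordFib_cons_self haway, sum_face]
      exact Finset.sum_congr rfl fun i _ => (fib_cell j u (reduced_tail hw) i).symm
    · rw [pointsAwayFrom_up_iff hu hw] at haway
      rw [sum_face, fib_cell j u (reduced_tail hw),
        Finset.sum_congr rfl fun i _ => fib_cell j u (reduced_tail hw) i]
      rcases List.suffix_cons_iff.1 haway with h1 | h1
      · obtain ⟨rfl, rfl⟩ := List.cons_eq_cons.1 h1
        exact wordFib_self _ _
      · exact wordFib_of_cons_suffix h1

/-- The three ones and the orientation of `e` towards `u` determine `u`; the path up to the root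
follows, then every branch downwards. -/
theorem IsFibonacciFunction.eq_fib {j : Fin 4} {u : List (Fin 4)} (hu : Reduced (j :: u))
    {F : Cell → ℝ} (hF : IsFibonacciFunction (face j u) F) : F = fib j u := by
  have hG := isFibonacciFunction_fib hu
  have hup : ∀ {k w}, k :: w <:+ j :: u →
      (∀ i, i ≠ k → F (cell w i) = fib j u (cell w i)) → ∀ i, F (cell w i) = fib j u (cell w i) := by
    intro k w hs h i
    by_cases hik : i = k
    · subst hik
      have hw := hu.suffix hs
      have ho := (isOrientedEdge_down hw).symm
      have ha := (pointsAwayFrom_up_iff hu hw).2 hs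
      rw [hF.eq_sum _ _ _ ho ha, hG.eq_sum _ _ _ ho ha, sum_face, sum_face]
      exact Finset.sum_congr rfl fun l hl => h l (Finset.ne_of_mem_erase hl)
    · exact h i hik
  have hpath : ∀ l w : List (Fin 4), l ++ w = u → ∀ i, F (cell w i) = fib j u (cell w i) := by
    intro l
    induction l using List.reverseRecOn with
    | nil =>
      intro w hw
      obtain rfl : w = u := hw
      refine hup List.suffix_rfl fun i hi => ?_
      rw [hF.eq_one _ (mem_face.2 ⟨i, hi, rfl⟩), hG.eq_one _ (mem_face.2 ⟨i, hi, rfl⟩)]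
    | append_singleton l k ih =>
      intro w hw
      have hw' : l ++ k :: w = u := by rw [← hw]; simp
      have hs : k :: w <:+ j :: u := List.IsSuffix.trans ⟨l, hw'⟩ (List.suffix_cons j u)
      refine hup hs fun i hi => ?_
      rw [← cell_cons_of_ne (hu.suffix hs) hi]
      exact ih _ hw' i
  have hall : ∀ w, Reduced w → ∀ i, F (cell w i) = fib j u (cell w i) := by
    intro w
    induction w with
    | nil => exact fun _ => hpath u [] (by simp)
    | cons k w ih =>
      intro hw i
      have ih := ih (reduced_tail hw)
      by_cases hs : k :: w <:+ u
      · obtain ⟨l, hl⟩ := hs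
        exact hpath l _ hl i
      by_cases hik : i = k
      · subst hik
        have ho := isOrientedEdge_down hw
        have ha := (pointsAwayFrom_down_iff hu hw).2 hs
        rw [hF.eq_sum _ _ _ ho ha, hG.eq_sum _ _ _ ho ha, sum_face, sum_face]
        exact Finset.sum_congr rfl fun l _ => ih l
      · rw [cell_cons_of_ne hw hik]
        exact ih i
  funext X
  rw [← cell_birth X]
  exact hall _ (reduced_birth X) _

/-! ### Transfer to `Ω` -/

theorem IsBQMarkoffMap.isBQWordMap {φ : Cell → ℂ} (hφ : IsBQMarkoffMap φ) :
    IsBQWordMap fun w i => φ (cell w i) where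
  keep h _ hi := by rw [cell_cons_of_ne h hi]
  vertex {w} hw := by
    have := hφ.vertex _ (tet_mem_Omega0 hw)
    rwa [tet, Finset.sum_image (cell_injective w).injOn,
      Finset.prod_image (cell_injective w).injOn] at this
  edge {j w} h := by
    have := hφ.edge _ _ _ (isOrientedEdge_down h)
    rwa [sum_face, prod_face] at this
  mul_ne {w} hw i j hij r hr h := by
    have hprod : ∏ X ∈ {cell w i, cell w j}, φ X = r := by
      rw [Finset.prod_pair fun h' => hij (cell_injective w h')]; exact h
    -- A product in `[0, 4]` has modulus at most `4`, so the restriction to `Ω²_φ(4)` in the BQ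
    -- condition costs nothing.
    refine hφ.not_mem_Icc {cell w i, cell w j} ⟨pair_mem_Omega2 hw hij, ?_⟩ r hr hprod
    rw [hprod, Complex.norm_real, Real.norm_of_nonneg hr.1]
    exact hr.2
  finite K := by
    rcases lt_or_ge K 0 with hK | hK
    · convert Set.finite_empty
      ext u
      simp only [Set.mem_ofPred_eq, Set.mem_empty_iff_false, iff_false]
      rintro ⟨-, j, w, -, i, -, h⟩
      exact ((norm_nonneg _).trans h).not_gt hK
    · refine (((hφ.finite K hK).biUnion fun s _ => s.finite_toSet).image Cell.birth).subset ?_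
      rintro _ ⟨hu, j, w, rfl, i, hij, h⟩
      refine ⟨cell (j :: w) j, Set.mem_biUnion (x := {cell (j :: w) j, cell (j :: w) i})
        ⟨pair_mem_Omega2 hu hij.symm, ?_⟩ (by simp), by rw [cell_cons_self hu]; rfl⟩
      rwa [Finset.prod_pair fun h' => hij (cell_injective _ h').symm]

theorem hasFibonacciGrowthOn_fib {φ : Cell → ℂ} (hφ : IsBQMarkoffMap φ) (j : Fin 4)
    (u : List (Fin 4)) :
    HasFibonacciGrowthOn (fib j u) (fun X => Real.posLog ‖φ X‖) Set.univ := by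
  obtain ⟨κ, hκ, hfin⟩ := hφ.isBQWordMap.exists_growth (isFibonacciWordMap_wordFib j u)
  refine ⟨κ, hκ, (((hfin.insert []).prod (Set.finite_univ (α := Fin 4))).image
    fun p => cell p.1 p.2).subset ?_⟩
  rintro X ⟨-, hX⟩
  refine ⟨(X.birth, X.color), ⟨?_, trivial⟩, cell_birth X⟩
  cases X with
  | base i => exact Or.inl rfl
  | apex k w h =>
    refine Or.inr ⟨h, k, w, rfl, ?_⟩
    simp only [Cell.birth, cell_cons_self h]
    exact hX

end MarkoffQuads

theorem mainTheorem5 (φ : MarkoffQuads.Cell → ℂ) (hφ : MarkoffQuads.IsBQMarkoffMap φ)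
    (e : Finset MarkoffQuads.Cell) (he : e ∈ MarkoffQuads.Omega1) :
    (∃! F : MarkoffQuads.Cell → ℝ, MarkoffQuads.IsFibonacciFunction e F) ∧
    ∀ F : MarkoffQuads.Cell → ℝ, MarkoffQuads.IsFibonacciFunction e F →
      MarkoffQuads.HasFibonacciGrowthOn F (fun X => Real.posLog ‖φ X‖) Set.univ := by
  obtain ⟨j, u, hu, rfl⟩ := MarkoffQuads.exists_face_of_mem_Omega1 he
  refine ⟨⟨MarkoffQuads.fib j u, MarkoffQuads.isFibonacciFunction_fib hu,
    fun F hF => hF.eq_fib hu⟩, fun F hF => ?_⟩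
  rw [hF.eq_fib hu]
  exact MarkoffQuads.hasFibonacciGrowthOn_fib hφ j u
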